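/- Let $D\in\mathbb R^{m\times N}$, $1\le K\le N$, $x\in\mathbb R^N$, and let $y=Dx+e$ with $e\in\mathbb R^m$. Let $\delta_k$ be the restricted isometry constant of $D$, i.e. the smallest $\delta\ge 0$ with $(1-\delta)\|v\|_2^2\le\|Dv\|_2^2\le(1+\delta)\|v\|_2^2$ for all $v$ with at most $k$ nonzero entries. Let $x_K$ be obtained from $x$ by setting to zero all entries except $K$ entries of largest magnitude. For a set $T$ of column indices let $D_T$ be the submatrix of $D$ with columns in $T$, and let $T_e$ maximize $\|D_T^{T}e\|_2$ over all $T$ with $|T|=K$. Consider the following three algorithms run with input $K$, $D$, $y$, starting from the zero estimate (empty support), where ties in selecting largest entries may be resolved arbitrarily, and let $\hat x^\ell$ be the estimate after $\ell$ iterations. Here $\mathrm{supp}(v,k)$ is a set of $\min(k,N)$ locations of largest magnitude in $v$, $D_T^\dagger=(D_T^TD_T)^{-1}D_T^T$, and vectors indexed by a set are extended by zero. - Subspace Pursuit (SP): from $T^{\ell-1}$ and $y_r=y-D_{T^{\ell-1}}D_{T^{\ell-1}}^\dagger y$ form $\tilde T=T^{\ell-1}\cup\mathrm{supp}(D^Ty_r,K)$,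 $x_p=D_{\tilde T}^\dagger y$, $T^\ell=\mathrm{supp}(x_p,K)$; the estimate is $\hat x^\ell=D_{T^\ell}^\dagger y$. RIP condition: $\delta_{3K}\le 0.139$. Constant: $C=2\,\frac{7-9\delta_{3K}+7\delta_{3K}^2-\delta_{3K}^3}{(1-\delta_{3K})^4}$. - CoSaMP: from $T^{\ell-1}$ and $y_r=y-D\hat x^{\ell-1}$ form $\tilde T=T^{\ell-1}\cup\mathrm{supp}(D^Ty_r,2K)$, $x_p=D_{\tilde T}^\dagger y$, $T^\ell=\mathrm{supp}(x_p,K)$; the estimate $\hat x^\ell$ equals $x_p$ on $T^\ell$ and $0$ elsewhere. RIP condition: $\delta_{4K}\le 0.1$. Constant: $C=\frac{29-14\delta_{4K}+\delta_{4K}^2}{(1-\delta_{4K})^2}$. - Iterative Hard Thresholding (IHT): $x_p=\hat x^{\ell-1}+D^T(y-D\hat x^{\ell-1})$, and $\hat x^\ell$ equals $x_p$ on $T^\ell=\mathrm{supp}(x_p,K)$ and $0$ elsewhere. RIP condition: $\delta_{3K}\le 1/\sqrt{32}$. Constant: $C=9$. Theorem. For each of the three algorithms, under its RIP condition, $C\le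 21.41$ (SP), $C\le 34.1$ (CoSaMP), $C=9$ (IHT), respectively, and the following hold. (1) If $D_{T_e}^Te\neq 0$ and $\ell^*=\left\lceil\log_2\frac{\|x\|_2}{\|D_{T_e}^Te\|_2}\right\rceil$, then for every $\ell\ge\max(\ell^*,0)$ (in particular after $\ell^*$ iterations; for $x=0$, for every $\ell\ge 0$) $$\|x-\hat x^\ell\|_2\le C\Big(\|D_{T_e}^Te\|_2+(1+\delta_K)\|x-x_K\|_2+\frac{1+\delta_K}{\sqrt K}\|x-x_K\|_1\Big).$$ (2) Assume moreover that the columns of $D$ have unit Euclidean norm, $N\ge 2$, $a>-1$, and that $e$ is a white Gaussian noise vector with variance $\sigma^2>0$ (independent $\mathcal N(0,\sigma^2)$ entries). Then there is an event of probability exceeding $1-\big(\sqrt{\pi(1+a)\log N}\cdot N^a\big)^{-1}$ on which $D_{T_e}^Te\ne0$ and, for every $\ell\ge\max(\ell^*,0)$ with $\ell^*$ as in (1) (again every $\ell\ge0$ if $x=0$), $$\|x-\hat x^\ell\|_2^2\le 2C^2\Big(\sqrt{(1+a)\log N\cdot K}\,\sigma+\|x-x_K\|_2+\frac1{\sqrt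 K}\|x-x_K\|_1\Big)^2.$$ -/

import Mathlib

open MeasureTheory ProbabilityTheory

namespace SparseRecovery

noncomputable section

/-- The Euclidean norm of a real vector. -/
def l2 {n : ℕ} (v : Fin n → ℝ) : ℝ := ‖WithLp.toLp 2 v‖

/-- The `ℓ₁` norm of a real vector. -/
def l1 {n : ℕ} (v : Fin n → ℝ) : ℝ := ‖WithLp.toLp 1 v‖

/-- The vector `v_T`, written as a full-length vector that vanishes outside `T`. -/
def restrict {n : ℕ} (T : Finset (Fin n)) (v : Fin n → ℝ) : Fin n → ℝ :=
  fun i => if i ∈ T then v i else 0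

/-- `S` is a possible value of `supp(v, k)`: a set of `k` locations (all of them, if there are
fewer than `k`) of largest magnitude in `v`. Ties may be resolved in any way. -/
def IsTopSupport {n : ℕ} (k : ℕ) (v : Fin n → ℝ) (S : Finset (Fin n)) : Prop :=
  S.card = min k n ∧ ∀ i ∈ S, ∀ j ∉ S, |v j| ≤ |v i|

/-- The restricted isometry constant `δ_k` of `D`: the smallest `δ` such that
`(1 - δ) ‖v‖² ≤ ‖D v‖² ≤ (1 + δ) ‖v‖²` for every `v` with at most `k` nonzero entries. -/
def ripConst {m N : ℕ} (D : Matrix (Fin m) (Fin N) ℝ) (k : ℕ) : ℝ :=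
  sInf {δ : ℝ | 0 ≤ δ ∧ ∀ v : Fin N → ℝ, (Finset.univ.filter fun i => v i ≠ 0).card ≤ k →
    (1 - δ) * l2 v ^ 2 ≤ l2 (D.mulVec v) ^ 2 ∧ l2 (D.mulVec v) ^ 2 ≤ (1 + δ) * l2 v ^ 2}

/-- The matrix `D_T` of the columns of `D` in `T`. -/
def subcols {m N : ℕ} (D : Matrix (Fin m) (Fin N) ℝ) (T : Finset (Fin N)) :
    Matrix (Fin m) T ℝ :=
  D.submatrix id Subtype.val

/-- The vector supported on `T` whose entries over `T` are `D_T^† y`, where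
`D_T^† = (D_Tᵀ D_T)⁻¹ D_Tᵀ` is the pseudo-inverse of a matrix of full column rank. (Under the
restricted isometry conditions below, all matrices `D_T` that occur have full column rank.) -/
def lsq {m N : ℕ} (D : Matrix (Fin m) (Fin N) ℝ) (T : Finset (Fin N)) (y : Fin m → ℝ) :
    Fin N → ℝ :=
  fun i => if h : i ∈ T then
    (((subcols D T).transpose * subcols D T)⁻¹ * (subcols D T).transpose).mulVec y ⟨i, h⟩ else 0

/-- `‖D_Tᵀ e‖₂`. -/
def corr {m N : ℕ} (D : Matrix (Fin m) (Fin N) ℝ) (T : Finset (Fin N)) (e : Fin m → ℝ) : ℝ :=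
  l2 (restrict T (D.transpose.mulVec e))

/-- `T` is a possible value of `T_e`: it maximizes `‖D_Tᵀ e‖₂` among the sets of size `K`. -/
def IsMaxCorr {m N : ℕ} (D : Matrix (Fin m) (Fin N) ℝ) (K : ℕ) (e : Fin m → ℝ)
    (T : Finset (Fin N)) : Prop :=
  T.card = K ∧ ∀ T' : Finset (Fin N), T'.card = K → corr D T' e ≤ corr D T e

/-- The three algorithms. -/
inductive Algorithm
  | SP
  | CoSaMP
  | IHT

/-- `xhat ℓ` is the Subspace Pursuit estimate after `ℓ` iterations, on input `D`, `y`, `K`.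
`T ℓ` is the support `T^ℓ`; `y - D (lsq D (T ℓ) y)` is the residual of the projection of `y` onto
the span of the columns in `T ℓ`. -/
def IsSPRun {m N : ℕ} (D : Matrix (Fin m) (Fin N) ℝ) (y : Fin m → ℝ) (K : ℕ)
    (xhat : ℕ → Fin N → ℝ) : Prop :=
  ∃ T : ℕ → Finset (Fin N), T 0 = ∅ ∧
    (∀ ℓ, ∃ TΔ : Finset (Fin N),
      IsTopSupport K (D.transpose.mulVec (y - D.mulVec (lsq D (T ℓ) y))) TΔ ∧
      IsTopSupport K (lsq D (T ℓ ∪ TΔ) y) (T (ℓ + 1))) ∧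
    ∀ ℓ, xhat ℓ = lsq D (T ℓ) y

/-- `xhat ℓ` is the CoSaMP estimate after `ℓ` iterations, on input `D`, `y`, `K`. -/
def IsCoSaMPRun {m N : ℕ} (D : Matrix (Fin m) (Fin N) ℝ) (y : Fin m → ℝ) (K : ℕ)
    (xhat : ℕ → Fin N → ℝ) : Prop :=
  ∃ T : ℕ → Finset (Fin N), T 0 = ∅ ∧ xhat 0 = 0 ∧
    ∀ ℓ, ∃ TΔ : Finset (Fin N),
      IsTopSupport (2 * K) (D.transpose.mulVec (y - D.mulVec (xhat ℓ))) TΔ ∧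
      IsTopSupport K (lsq D (T ℓ ∪ TΔ) y) (T (ℓ + 1)) ∧
      xhat (ℓ + 1) = restrict (T (ℓ + 1)) (lsq D (T ℓ ∪ TΔ) y)

/-- `xhat ℓ` is the Iterative Hard Thresholding estimate after `ℓ` iterations, on input
`D`, `y`, `K`. -/
def IsIHTRun {m N : ℕ} (D : Matrix (Fin m) (Fin N) ℝ) (y : Fin m → ℝ) (K : ℕ)
    (xhat : ℕ → Fin N → ℝ) : Prop :=
  xhat 0 = 0 ∧
    ∀ ℓ, ∃ T : Finset (Fin N),
      IsTopSupport K (xhat ℓ + D.transpose.mulVec (y - D.mulVec (xhat ℓ))) T ∧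
      xhat (ℓ + 1) = restrict T (xhat ℓ + D.transpose.mulVec (y - D.mulVec (xhat ℓ)))

/-- `xhat` is the sequence of estimates of a run of the given algorithm (for some resolution of
ties in the selection steps). -/
def IsRun {m N : ℕ} : Algorithm → Matrix (Fin m) (Fin N) ℝ → (Fin m → ℝ) → ℕ →
    (ℕ → Fin N → ℝ) → Prop
  | .SP => IsSPRun
  | .CoSaMP => IsCoSaMPRun
  | .IHT => IsIHTRun

/-- The restricted isometry condition of each algorithm. -/
def RIPCondition {m N : ℕ} (D : Matrix (Fin m) (Fin N) ℝ) (K : ℕ) : Algorithm → Prop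
  | .SP => ripConst D (3 * K) ≤ 0.139
  | .CoSaMP => ripConst D (4 * K) ≤ 0.1
  | .IHT => ripConst D (3 * K) ≤ 1 / √32

/-- The constants `C_SP`, `C_CoSaMP` and `C_IHT`. -/
def errConst {m N : ℕ} (D : Matrix (Fin m) (Fin N) ℝ) (K : ℕ) : Algorithm → ℝ
  | .SP =>
    let δ := ripConst D (3 * K)
    2 * ((7 - 9 * δ + 7 * δ ^ 2 - δ ^ 3) / (1 - δ) ^ 4)
  | .CoSaMP =>
    let δ := ripConst D (4 * K)
    (29 - 14 * δ + δ ^ 2) / (1 - δ) ^ 2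
  | .IHT => 9

/-- The absolute upper bounds for the constants of the three algorithms. -/
def absConst : Algorithm → ℝ
  | .SP => 21.41
  | .CoSaMP => 34.1
  | .IHT => 9

/-- The number of iterations `ℓ* = ⌈log₂ (‖x‖₂ / ‖D_Tᵀ e‖₂)⌉` (used with `T = T_e`). -/
def numIter {m N : ℕ} (D : Matrix (Fin m) (Fin N) ℝ) (x : Fin N → ℝ) (T : Finset (Fin N))
    (e : Fin m → ℝ) : ℤ :=
  ⌈Real.logb 2 (l2 x / corr D T e)⌉

/-- `e` is a white Gaussian noise vector of variance `σ²`: its entries are independent, centred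
Gaussian variables of variance `σ²`. -/
def IsWhiteGaussian {Ω : Type*} [MeasurableSpace Ω] (P : Measure Ω) {m : ℕ} (σ : ℝ)
    (e : Ω → Fin m → ℝ) : Prop :=
  (∀ i, HasLaw (fun ω => e ω i) (gaussianReal 0 ⟨σ ^ 2, sq_nonneg σ⟩) P) ∧
    iIndepFun (fun i ω => e ω i) P

end

end SparseRecovery

namespace SparseRecovery

open scoped Matrix NNReal

section Vectors

variable {n : ℕ}

lemma l2_nonneg (v : Fin n → ℝ) : 0 ≤ l2 v := norm_nonneg _

lemma l1_nonneg (v : Fin n → ℝ) : 0 ≤ l1 v := norm_nonneg _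

lemma l2_sq (v : Fin n → ℝ) : l2 v ^ 2 = ∑ i, v i ^ 2 := by
  simp [l2, EuclideanSpace.norm_sq_eq]

lemma l1_eq (v : Fin n → ℝ) : l1 v = ∑ i, |v i| := by
  simp [l1, PiLp.norm_eq_of_L1]

lemma l2_sq_eq_dotProduct (v : Fin n → ℝ) : l2 v ^ 2 = v ⬝ᵥ v := by
  rw [l2_sq]; simp [dotProduct, sq]

@[simp] lemma l2_zero : l2 (0 : Fin n → ℝ) = 0 := by simp [l2]

lemma l2_eq_zero {v : Fin n → ℝ} (h : l2 v = 0) : v = 0 := by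
  simpa [l2] using h

lemma l2_add_le (v w : Fin n → ℝ) : l2 (v + w) ≤ l2 v + l2 w := by
  simpa [l2] using norm_add_le (WithLp.toLp 2 v) (WithLp.toLp 2 w)

@[simp] lemma l2_neg (v : Fin n → ℝ) : l2 (-v) = l2 v := by
  simp [l2]

lemma l2_sub_comm (v w : Fin n → ℝ) : l2 (v - w) = l2 (w - v) := by
  rw [← l2_neg, neg_sub]

lemma l2_sub_le (v w : Fin n → ℝ) : l2 (v - w) ≤ l2 v + l2 w := by
  simpa [sub_eq_add_neg] using l2_add_le v (-w)

lemma dotProduct_le_l2_mul_l2 (v w : Fin n → ℝ) : v ⬝ᵥ w ≤ l2 v * l2 w := by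
  have h := real_inner_le_norm (WithLp.toLp 2 w) (WithLp.toLp 2 v)
  rw [EuclideanSpace.inner_toLp_toLp] at h
  simpa [l2, mul_comm] using h

lemma l2_le_of_sq_le {m : ℕ} {v : Fin n → ℝ} {w : Fin m → ℝ}
    (h : l2 v ^ 2 ≤ l2 w ^ 2) : l2 v ≤ l2 w :=
  le_of_sq_le_sq h (l2_nonneg w)

lemma l2_sq_restrict (T : Finset (Fin n)) (v : Fin n → ℝ) :
    l2 (restrict T v) ^ 2 = ∑ i ∈ T, v i ^ 2 := by
  simp [l2_sq, restrict, ite_pow, Finset.sum_ite_mem]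

lemma l2_restrict_mono {S T : Finset (Fin n)} (h : S ⊆ T) (v : Fin n → ℝ) :
    l2 (restrict S v) ≤ l2 (restrict T v) := by
  refine l2_le_of_sq_le ?_
  rw [l2_sq_restrict, l2_sq_restrict]
  exact Finset.sum_le_sum_of_subset_of_nonneg h fun _ _ _ => sq_nonneg _

lemma l2_restrict_le (T : Finset (Fin n)) (v : Fin n → ℝ) : l2 (restrict T v) ≤ l2 v := by
  refine l2_le_of_sq_le ?_
  rw [l2_sq_restrict, l2_sq]
  exact Finset.sum_le_sum_of_subset_of_nonneg (Finset.subset_univ _) fun _ _ _ => sq_nonneg _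

lemma restrict_add (T : Finset (Fin n)) (v w : Fin n → ℝ) :
    restrict T (v + w) = restrict T v + restrict T w := by
  ext i; by_cases h : i ∈ T <;> simp [restrict, h]

lemma restrict_sub (T : Finset (Fin n)) (v w : Fin n → ℝ) :
    restrict T (v - w) = restrict T v - restrict T w := by
  ext i; by_cases h : i ∈ T <;> simp [restrict, h]

lemma restrict_congr {T : Finset (Fin n)} {v w : Fin n → ℝ} (h : ∀ i ∈ T, v i = w i) :
    restrict T v = restrict T w := by
  ext i; by_cases hi : i ∈ T <;> simp [restrict, hi, h]

lemma restrict_eq_self {T : Finset (Fin n)} {v : Fin n → ℝ} (h : ∀ i ∉ T, v i = 0) :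
    restrict T v = v := by
  ext i; by_cases hi : i ∈ T <;> simp [restrict, hi, h]

lemma restrict_apply_of_notMem {T : Finset (Fin n)} (v : Fin n → ℝ) {i : Fin n} (h : i ∉ T) :
    restrict T v i = 0 := by simp [restrict, h]

lemma restrict_eq_zero {T : Finset (Fin n)} {v : Fin n → ℝ} (h : ∀ i ∈ T, v i = 0) :
    restrict T v = 0 := by
  ext i; by_cases hi : i ∈ T <;> simp [restrict, hi, h]

lemma l2_restrict_add_le (T : Finset (Fin n)) (v w : Fin n → ℝ) :
    l2 (restrict T (v + w)) ≤ l2 (restrict T v) + l2 (restrict T w) := by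
  rw [restrict_add]; exact l2_add_le _ _

lemma l2_restrict_sub_le (T : Finset (Fin n)) (v w : Fin n → ℝ) :
    l2 (restrict T (v - w)) ≤ l2 (restrict T v) + l2 (restrict T w) := by
  rw [restrict_sub]; exact l2_sub_le _ _

lemma l2_restrict_union_le (S T : Finset (Fin n)) (v : Fin n → ℝ) :
    l2 (restrict (S ∪ T) v) ≤ l2 (restrict S v) + l2 (restrict T v) := by
  have h : restrict (S ∪ T) v = restrict S v + restrict (T \ S) v := by
    ext i; by_cases hS : i ∈ S <;> by_cases hT : i ∈ T <;> simp [restrict, hS, hT]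
  rw [h]
  exact (l2_add_le _ _).trans (by gcongr; exact l2_restrict_mono Finset.sdiff_subset v)

lemma dotProduct_restrict (T : Finset (Fin n)) (v w : Fin n → ℝ) :
    v ⬝ᵥ restrict T w = restrict T v ⬝ᵥ restrict T w := by
  simp only [dotProduct]
  refine Finset.sum_congr rfl fun i _ => ?_
  by_cases h : i ∈ T <;> simp [restrict, h]

lemma card_support_le {R : Finset (Fin n)} {v : Fin n → ℝ} (h : ∀ i ∉ R, v i = 0) :
    (Finset.univ.filter fun i => v i ≠ 0).card ≤ R.card :=
  Finset.card_le_card fun i hi => by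
    by_contra hR; exact (Finset.mem_filter.1 hi).2 (h i hR)

/-- The largest entries dominate any other set of at most as many entries. -/
lemma IsTopSupport.l2_sdiff_le {k : ℕ} {v : Fin n → ℝ} {S : Finset (Fin n)}
    (hS : IsTopSupport k v S) {T : Finset (Fin n)} (hT : T.card ≤ k) :
    l2 (restrict (T \ S) v) ≤ l2 (restrict (S \ T) v) := by
  have hTS : T.card ≤ S.card := by
    rw [hS.1]; exact le_min hT (by simpa using Finset.card_le_univ T)
  have hc : (T \ S).card ≤ (S \ T).card := by
    have h1 := Finset.card_sdiff_add_card_inter T S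
    have h2 := Finset.card_sdiff_add_card_inter S T
    rw [Finset.inter_comm] at h2; omega
  refine l2_le_of_sq_le ?_
  rw [l2_sq_restrict, l2_sq_restrict]
  rcases (T \ S).eq_empty_or_nonempty with h | h
  · rw [h, Finset.sum_empty]; exact Finset.sum_nonneg fun _ _ => sq_nonneg _
  obtain ⟨i₀, hi₀, hmax⟩ := Finset.exists_max_image (T \ S) (fun i => v i ^ 2) h
  calc ∑ i ∈ T \ S, v i ^ 2 ≤ (T \ S).card • v i₀ ^ 2 := Finset.sum_le_card_nsmul _ _ _ hmax
    _ ≤ (S \ T).card • v i₀ ^ 2 := nsmul_le_nsmul_left (sq_nonneg _) hc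
    _ ≤ ∑ i ∈ S \ T, v i ^ 2 := Finset.card_nsmul_le_sum _ _ _ fun j hj =>
        sq_le_sq.2 (hS.2 j (Finset.mem_sdiff.1 hj).1 i₀ (Finset.mem_sdiff.1 hi₀).2)

/-- Keeping the `k` largest entries gives a best `k`-sparse approximation. -/
lemma IsTopSupport.l2_sub_restrict_le {k : ℕ} {v : Fin n → ℝ} {S : Finset (Fin n)}
    (hS : IsTopSupport k v S) {T : Finset (Fin n)} (hT : T.card ≤ k) {x : Fin n → ℝ}
    (hx : ∀ i ∉ T, x i = 0) {R : Finset (Fin n)} (hTR : T ⊆ R) (hSR : S ⊆ R) :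
    l2 (restrict R (v - restrict S v)) ≤ l2 (restrict R (x - v)) := by
  refine le_of_sq_le_sq ?_ (l2_nonneg _)
  have h := hS.l2_sdiff_le hT
  have h2 := pow_le_pow_left₀ (l2_nonneg _) h 2
  rw [l2_sq_restrict, l2_sq_restrict] at h2
  have e1 : ∑ i ∈ R, (v - restrict S v) i ^ 2 = ∑ i ∈ R \ S, v i ^ 2 := by
    rw [← Finset.sum_sdiff hSR]
    rw [Finset.sum_eq_zero (s := S) (fun i hi => by simp [restrict, hi]), add_zero]
    exact Finset.sum_congr rfl fun i hi => by simp [restrict, (Finset.mem_sdiff.1 hi).2]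
  have e2 : ∑ i ∈ R \ T, v i ^ 2 ≤ ∑ i ∈ R, (x - v) i ^ 2 := by
    rw [← Finset.sum_sdiff hTR]
    have : ∑ i ∈ R \ T, (x - v) i ^ 2 = ∑ i ∈ R \ T, v i ^ 2 :=
      Finset.sum_congr rfl fun i hi => by simp [hx i (Finset.mem_sdiff.1 hi).2]
    rw [this]
    exact le_add_of_nonneg_right (Finset.sum_nonneg fun _ _ => sq_nonneg _)
  have e3 : ∑ i ∈ R \ S, v i ^ 2 = ∑ i ∈ R \ (S ∪ T), v i ^ 2 + ∑ i ∈ T \ S, v i ^ 2 := by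
    rw [← Finset.sum_union (Finset.disjoint_left.2 (by simp; tauto))]
    congr 1; ext i
    have := @hTR i
    simp; tauto
  have e4 : ∑ i ∈ R \ T, v i ^ 2 = ∑ i ∈ R \ (S ∪ T), v i ^ 2 + ∑ i ∈ S \ T, v i ^ 2 := by
    rw [← Finset.sum_union (Finset.disjoint_left.2 (by simp; tauto))]
    congr 1; ext i
    have := @hSR i
    simp; tauto
  rw [l2_sq_restrict, l2_sq_restrict, e1]
  linarith

end Vectors

section RIP

variable {m N : ℕ} {D : Matrix (Fin m) (Fin N) ℝ} {k : ℕ} {δ : ℝ}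

/-- `δ` is an admissible restricted isometry bound of order `k` for `D`. -/
def HasRIP (D : Matrix (Fin m) (Fin N) ℝ) (k : ℕ) (δ : ℝ) : Prop :=
  0 ≤ δ ∧ ∀ v : Fin N → ℝ, (Finset.univ.filter fun i => v i ≠ 0).card ≤ k →
    (1 - δ) * l2 v ^ 2 ≤ l2 (D *ᵥ v) ^ 2 ∧ l2 (D *ᵥ v) ^ 2 ≤ (1 + δ) * l2 v ^ 2

lemma exists_hasRIP (D : Matrix (Fin m) (Fin N) ℝ) (k : ℕ) : ∃ δ, HasRIP D k δ := by
  set c := ∑ i, l2 (D i) ^ 2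
  have hc : 0 ≤ c := Finset.sum_nonneg fun _ _ => sq_nonneg _
  refine ⟨1 + c, by positivity, fun v _ => ⟨?_, ?_⟩⟩
  · have := mul_nonneg hc (sq_nonneg (l2 v))
    have := sq_nonneg (l2 (D *ᵥ v))
    nlinarith
  · have h : l2 (D *ᵥ v) ^ 2 ≤ c * l2 v ^ 2 := by
      rw [l2_sq, Finset.sum_mul]
      refine Finset.sum_le_sum fun i _ => ?_
      rw [← mul_pow]
      refine sq_le_sq' ?_ (dotProduct_le_l2_mul_l2 (D i) v)
      have := dotProduct_le_l2_mul_l2 (-D i) v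
      rw [neg_dotProduct, l2_neg] at this
      change _ ≤ D i ⬝ᵥ v
      linarith
    nlinarith [sq_nonneg (l2 v)]

/-- The infimum defining the restricted isometry constant is attained. -/
lemma hasRIP_ripConst (D : Matrix (Fin m) (Fin N) ℝ) (k : ℕ) : HasRIP D k (ripConst D k) := by
  have hne : {δ : ℝ | HasRIP D k δ}.Nonempty := exists_hasRIP D k
  have hbd : BddBelow {δ : ℝ | HasRIP D k δ} := ⟨0, fun δ h => h.1⟩
  have hcl : IsClosed {δ : ℝ | HasRIP D k δ} := by
    simp only [HasRIP, Set.ofPred_and, Set.ofPred_forall]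
    refine (isClosed_le (by fun_prop) (by fun_prop)).inter <| isClosed_iInter fun v =>
      isClosed_iInter fun _ => (isClosed_le (by fun_prop) (by fun_prop)).inter
        (isClosed_le (by fun_prop) (by fun_prop))
  exact hcl.csInf_mem hne hbd

lemma HasRIP.mono (h : HasRIP D k δ) {j : ℕ} (hjk : j ≤ k) : HasRIP D j δ :=
  ⟨h.1, fun v hv => h.2 v (hv.trans hjk)⟩

lemma HasRIP.ripConst_le (h : HasRIP D k δ) : ripConst D k ≤ δ :=
  csInf_le ⟨0, fun _ h => h.1⟩ h

lemma ripConst_nonneg (D : Matrix (Fin m) (Fin N) ℝ) (k : ℕ) : 0 ≤ ripConst D k :=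
  (hasRIP_ripConst D k).1

lemma ripConst_mono (D : Matrix (Fin m) (Fin N) ℝ) {j k : ℕ} (hjk : j ≤ k) :
    ripConst D j ≤ ripConst D k :=
  ((hasRIP_ripConst D k).mono hjk).ripConst_le

lemma dotProduct_transpose_mulVec (D : Matrix (Fin m) (Fin N) ℝ) (u : Fin m → ℝ)
    (v : Fin N → ℝ) : v ⬝ᵥ (Dᵀ *ᵥ u) = u ⬝ᵥ (D *ᵥ v) := by
  rw [Matrix.mulVec_transpose, dotProduct_comm, ← Matrix.dotProduct_mulVec]

lemma HasRIP.l2_mulVec_le (h : HasRIP D k δ) {v : Fin N → ℝ} {R : Finset (Fin N)}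
    (hR : R.card ≤ k) (hv : ∀ i ∉ R, v i = 0) : l2 (D *ᵥ v) ≤ √(1 + δ) * l2 v := by
  have h1 := (h.2 v ((card_support_le hv).trans hR)).2
  have h0 := h.1
  refine le_of_sq_le_sq ?_ (mul_nonneg (Real.sqrt_nonneg _) (l2_nonneg _))
  rwa [mul_pow, Real.sq_sqrt (by linarith)]

/-- Vectors supported in a common small set are almost orthogonally invariant under `D`. -/
lemma HasRIP.dotProduct_sub_le (h : HasRIP D k δ) {u v : Fin N → ℝ} {R : Finset (Fin N)}
    (hR : R.card ≤ k) (hu : ∀ i ∉ R, u i = 0) (hv : ∀ i ∉ R, v i = 0) :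
    (D *ᵥ u) ⬝ᵥ (D *ᵥ v) - u ⬝ᵥ v ≤ δ * (l2 u * l2 v) := by
  rcases eq_or_ne (l2 u) 0 with h0 | h0
  · simp [l2_eq_zero h0]
  rcases eq_or_ne (l2 v) 0 with h1 | h1
  · simp [l2_eq_zero h1]
  have pu : 0 < l2 u := lt_of_le_of_ne (l2_nonneg u) h0.symm
  have pv : 0 < l2 v := lt_of_le_of_ne (l2_nonneg v) h1.symm
  set a := l2 v
  set b := l2 u
  have e1 := (h.2 (a • u + b • v) ((card_support_le (R := R) fun i hi => by
    simp [hu i hi, hv i hi]).trans hR)).2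
  have e2 := (h.2 (a • u - b • v) ((card_support_le (R := R) fun i hi => by
    simp [hu i hi, hv i hi]).trans hR)).1
  have hsu : u ⬝ᵥ u = b ^ 2 := (l2_sq_eq_dotProduct u).symm
  have hsv : v ⬝ᵥ v = a ^ 2 := (l2_sq_eq_dotProduct v).symm
  simp only [l2_sq_eq_dotProduct, Matrix.mulVec_add, Matrix.mulVec_sub, Matrix.mulVec_smul,
    add_dotProduct, sub_dotProduct, dotProduct_add, dotProduct_sub, smul_dotProduct,
    dotProduct_smul, smul_eq_mul, dotProduct_comm v u, hsu, hsv,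
    dotProduct_comm (D *ᵥ v) (D *ᵥ u)] at e1 e2
  have hab : 0 < a * b := mul_pos pv pu
  have : (a * b) * ((D *ᵥ u) ⬝ᵥ (D *ᵥ v) - u ⬝ᵥ v) ≤ (a * b) * (δ * (b * a)) := by
    nlinarith
  exact le_of_mul_le_mul_left this hab

/-- On small sets, `DᵀD` acts almost as the identity on sparse vectors. -/
lemma HasRIP.l2_restrict_gram_sub_le (h : HasRIP D k δ) {w : Fin N → ℝ}
    {R U : Finset (Fin N)} (hR : (R ∪ U).card ≤ k) (hw : ∀ i ∉ R, w i = 0) :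
    l2 (restrict U (Dᵀ *ᵥ (D *ᵥ w) - w)) ≤ δ * l2 w := by
  set u := restrict U (Dᵀ *ᵥ (D *ᵥ w) - w) with hu
  have h1 : l2 u ^ 2 = (D *ᵥ w) ⬝ᵥ (D *ᵥ u) - w ⬝ᵥ u := by
    rw [l2_sq_eq_dotProduct]
    conv_lhs => rw [hu, ← dotProduct_restrict, ← hu, sub_dotProduct, dotProduct_comm,
      dotProduct_transpose_mulVec]
  have h2 := h.dotProduct_sub_le (u := w) (v := u) hR
    (fun i hi => hw i fun h => hi (Finset.mem_union_left _ h))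
    (fun i hi => restrict_apply_of_notMem _ fun h => hi (Finset.mem_union_right _ h))
  rcases (l2_nonneg u).eq_or_lt with h0 | h0
  · rw [← h0]; exact mul_nonneg h.1 (l2_nonneg w)
  · refine le_of_mul_le_mul_right ?_ h0
    linarith

/-- `‖D_Uᵀ u‖ ≤ √(1 + δ) ‖u‖` for sets `U` of size at most `k`. -/
lemma HasRIP.corr_le (h : HasRIP D k δ) {U : Finset (Fin N)} (hU : U.card ≤ k)
    (u : Fin m → ℝ) : corr D U u ≤ √(1 + δ) * l2 u := by
  unfold corr
  set z := restrict U (Dᵀ *ᵥ u) with hz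
  have h1 : l2 z ^ 2 = u ⬝ᵥ (D *ᵥ z) := by
    rw [l2_sq_eq_dotProduct]
    conv_lhs => rw [hz, ← dotProduct_restrict, ← hz, dotProduct_comm,
      dotProduct_transpose_mulVec]
  have h2 := dotProduct_le_l2_mul_l2 u (D *ᵥ z)
  have h3 := h.l2_mulVec_le hU (v := z) fun i hi => restrict_apply_of_notMem _ hi
  have h4 := mul_le_mul_of_nonneg_left h3 (l2_nonneg u)
  rcases (l2_nonneg z).eq_or_lt with h0 | h0
  · rw [← h0]; exact mul_nonneg (Real.sqrt_nonneg _) (l2_nonneg u)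
  · refine le_of_mul_le_mul_right ?_ h0
    linarith

lemma exists_isTopSupport (k : ℕ) (v : Fin N → ℝ) : ∃ S, IsTopSupport k v S := by
  induction k with
  | zero => exact ⟨∅, by simp [IsTopSupport]⟩
  | succ k ih =>
    obtain ⟨S, hS, htop⟩ := ih
    by_cases hk : N ≤ k
    · exact ⟨S, by rw [hS]; omega, htop⟩
    have hne : Sᶜ.Nonempty := by
      rw [← Finset.card_pos, Finset.card_compl, hS, Fintype.card_fin]; omega
    obtain ⟨j, hj, hmax⟩ := Finset.exists_max_image Sᶜ (fun i => |v i|) hne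
    have hjS := Finset.mem_compl.1 hj
    refine ⟨insert j S, by rw [Finset.card_insert_of_notMem hjS, hS]; omega, ?_⟩
    intro i hi l hl
    simp only [Finset.mem_insert, not_or] at hi hl
    rcases hi with rfl | hi
    · exact hmax l (Finset.mem_compl.2 hl.2)
    · exact htop i hi l hl.2

lemma l2_le_of_forall_abs_le {v : Fin N → ℝ} {R : Finset (Fin N)} (hR : R.card ≤ k)
    (hv : ∀ i ∉ R, v i = 0) {M : ℝ} (hM : ∀ i, |v i| ≤ M) (hM0 : 0 ≤ M) : l2 v ≤ √k * M := by
  refine le_of_sq_le_sq ?_ (mul_nonneg (Real.sqrt_nonneg _) hM0)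
  rw [mul_pow, Real.sq_sqrt (Nat.cast_nonneg k), ← restrict_eq_self hv, l2_sq_restrict]
  calc ∑ i ∈ R, v i ^ 2 ≤ R.card • M ^ 2 :=
        Finset.sum_le_card_nsmul _ _ _ fun i _ => by
          rw [← sq_abs]; exact pow_le_pow_left₀ (abs_nonneg _) (hM i) 2
    _ ≤ k * M ^ 2 := by
        rw [nsmul_eq_mul]; gcongr

lemma l1_restrict_add (B : Finset (Fin N)) (v : Fin N → ℝ) :
    l1 (restrict B v) + l1 (v - restrict B v) = l1 v := by
  simp only [l1_eq, ← Finset.sum_add_distrib]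
  refine Finset.sum_congr rfl fun i _ => ?_
  by_cases h : i ∈ B <;> simp [restrict, h]

lemma IsTopSupport.abs_sub_restrict_le {v : Fin N → ℝ} {B : Finset (Fin N)}
    (hB : IsTopSupport k v B) (hk : 1 ≤ k) (hkN : k ≤ N) (i : Fin N) :
    |(v - restrict B v) i| ≤ l1 (restrict B v) / k := by
  by_cases hi : i ∈ B
  · simpa [restrict, hi] using div_nonneg (l1_nonneg _) (Nat.cast_nonneg k)
  rw [le_div_iff₀ (by exact_mod_cast hk), l1_eq]
  have h1 : ∑ j, |restrict B v j| = ∑ j ∈ B, |v j| := by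
    simp [restrict, apply_ite abs, Finset.sum_ite_mem]
  have h2 := Finset.card_nsmul_le_sum B (fun j => |v j|) |v i| fun j hj => hB.2 j hj i hi
  rw [hB.1, min_eq_left hkN, nsmul_eq_mul, mul_comm] at h2
  rw [h1]
  simpa [restrict, hi] using h2

/-- Block decomposition: the image of a vector with entries bounded by `M`. -/
lemma HasRIP.l2_mulVec_le_of_abs_le (h : HasRIP D k δ) (hk : 1 ≤ k) (hkN : k ≤ N) (n : ℕ) :
    ∀ (v : Fin N → ℝ) (R : Finset (Fin N)), R.card ≤ n → (∀ i ∉ R, v i = 0) →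
      ∀ M, (∀ i, |v i| ≤ M) → l2 (D *ᵥ v) ≤ √(1 + δ) * (√k * M + l1 v / √k) := by
  have hk0 : (0 : ℝ) < √k := Real.sqrt_pos.2 (by exact_mod_cast hk)
  induction n using Nat.strong_induction_on with
  | _ n ih =>
    intro v R hRn hv M hM
    have hM0 : 0 ≤ M := (abs_nonneg _).trans (hM ⟨0, by omega⟩)
    by_cases hRk : R.card ≤ k
    · refine (h.l2_mulVec_le hRk hv).trans ?_
      gcongr
      exact (l2_le_of_forall_abs_le hRk hv hM hM0).trans
        (le_add_of_nonneg_right (div_nonneg (l1_nonneg _) hk0.le))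
    obtain ⟨B, hB⟩ := exists_isTopSupport k v
    set v' := v - restrict B v with hv'
    have hBc : B.card = k := by rw [hB.1, min_eq_left hkN]
    have hsplit : D *ᵥ v = D *ᵥ restrict B v + D *ᵥ v' := by
      rw [← Matrix.mulVec_add, hv', add_sub_cancel]
    -- the support shrinks
    obtain ⟨R', hR', hsupp⟩ : ∃ R' : Finset (Fin N), R'.card < n ∧ ∀ i ∉ R', v' i = 0 := by
      by_cases hBR : (R ∩ B).Nonempty
      · refine ⟨R \ B, ?_, fun i hi => ?_⟩
        · have := Finset.card_sdiff_add_card_inter R B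
          have := hBR.card_pos
          omega
        · by_cases hiB : i ∈ B
          · simp [hv', restrict, hiB]
          · have : i ∉ R := fun h => hi (Finset.mem_sdiff.2 ⟨h, hiB⟩)
            simp [hv', restrict, hiB, hv i this]
      · have hB0 : ∀ j ∈ B, v j = 0 := fun j hj =>
          hv j fun h => hBR ⟨j, Finset.mem_inter.2 ⟨h, hj⟩⟩
        have hv0 : v = 0 := by
          have hBne : B.Nonempty := Finset.card_pos.1 (by omega)
          obtain ⟨j, hj⟩ := hBne
          ext i
          by_cases hi : i ∈ B
          · exact hB0 i hi
          · have := hB.2 j hj i hi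
            rw [hB0 j hj, abs_zero] at this
            exact abs_nonpos_iff.1 this
        exact ⟨∅, by simp; omega, fun i _ => by simp [hv', hv0, restrict]⟩
    have h1 := ih R'.card hR' v' R' le_rfl hsupp _ (hB.abs_sub_restrict_le hk hkN)
    have h2 : l2 (D *ᵥ restrict B v) ≤ √(1 + δ) * (√k * M) := by
      refine (h.l2_mulVec_le hBc.le fun i hi => restrict_apply_of_notMem v hi).trans ?_
      gcongr
      refine l2_le_of_forall_abs_le hBc.le (fun i hi => restrict_apply_of_notMem v hi)
        (fun i => ?_) hM0
      by_cases hi : i ∈ B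
      · simpa [restrict, hi] using hM i
      · simpa [restrict, hi] using hM0
    have h3 : √k * (l1 (restrict B v) / k) = l1 (restrict B v) / √k := by
      rw [mul_div_assoc', mul_comm, mul_div_assoc, Real.sqrt_div_self', mul_one_div]
    rw [h3, ← add_div, l1_restrict_add] at h1
    calc l2 (D *ᵥ v) ≤ l2 (D *ᵥ restrict B v) + l2 (D *ᵥ v') := hsplit ▸ l2_add_le _ _
      _ ≤ _ := by rw [mul_add]; exact add_le_add h2 h1

/-- `‖D v‖ ≤ √(1 + δ_k) (‖v‖₂ + ‖v‖₁ / √k)` for every vector `v`. -/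
lemma HasRIP.l2_mulVec_le_add (h : HasRIP D k δ) (hk : 1 ≤ k) (hkN : k ≤ N)
    (v : Fin N → ℝ) : l2 (D *ᵥ v) ≤ √(1 + δ) * (l2 v + l1 v / √k) := by
  obtain ⟨B, hB⟩ := exists_isTopSupport k v
  have hBc : B.card = k := by rw [hB.1, min_eq_left hkN]
  have h1 := h.l2_mulVec_le_of_abs_le hk hkN N (v - restrict B v) Finset.univ (by simp)
    (by simp) _ (hB.abs_sub_restrict_le hk hkN)
  have h2 := h.l2_mulVec_le hBc.le fun i hi => restrict_apply_of_notMem v hi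
  have h3 : √k * (l1 (restrict B v) / k) = l1 (restrict B v) / √k := by
    rw [mul_div_assoc', mul_comm, mul_div_assoc, Real.sqrt_div_self', mul_one_div]
  rw [h3, ← add_div, l1_restrict_add] at h1
  have hsplit : D *ᵥ v = D *ᵥ restrict B v + D *ᵥ (v - restrict B v) := by
    rw [← Matrix.mulVec_add, add_sub_cancel]
  calc l2 (D *ᵥ v) ≤ l2 (D *ᵥ restrict B v) + l2 (D *ᵥ (v - restrict B v)) :=
        hsplit ▸ l2_add_le _ _
    _ ≤ √(1 + δ) * l2 v + √(1 + δ) * (l1 v / √k) := by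
        refine add_le_add (h2.trans ?_) h1
        gcongr
        exact l2_restrict_le B v
    _ = _ := by ring

/-- The effect of a non-sparse residual on the correlations. -/
lemma HasRIP.corr_mulVec_le (h : HasRIP D k δ) (hk : 1 ≤ k) (hkN : k ≤ N)
    {U : Finset (Fin N)} (hU : U.card ≤ k) (v : Fin N → ℝ) :
    corr D U (D *ᵥ v) ≤ (1 + δ) * (l2 v + l1 v / √k) := by
  have h0 := h.1
  refine (h.corr_le hU _).trans ?_
  refine (mul_le_mul_of_nonneg_left (h.l2_mulVec_le_add hk hkN v) (Real.sqrt_nonneg _)).trans ?_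
  rw [← mul_assoc, Real.mul_self_sqrt (by linarith)]

lemma corr_add_le (U : Finset (Fin N)) (e e' : Fin m → ℝ) :
    corr D U (e + e') ≤ corr D U e + corr D U e' := by
  simp only [corr, Matrix.mulVec_add]
  exact l2_restrict_add_le _ _ _

lemma corr_nonneg (U : Finset (Fin N)) (e : Fin m → ℝ) : 0 ≤ corr D U e := l2_nonneg _

lemma corr_mono {S U : Finset (Fin N)} (h : S ⊆ U) (e : Fin m → ℝ) :
    corr D S e ≤ corr D U e := l2_restrict_mono h _

/-- Correlations on larger sets. -/
lemma corr_le_mul {η : ℝ} {e : Fin m → ℝ} (h : ∀ U : Finset (Fin N), U.card ≤ k →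
    corr D U e ≤ η) (n : ℕ) : ∀ U : Finset (Fin N), U.card ≤ n * k → corr D U e ≤ n * η := by
  induction n with
  | zero =>
    intro U hU
    have : U = ∅ := by simpa using hU
    have h0 : restrict (∅ : Finset (Fin N)) (Dᵀ *ᵥ e) = 0 := restrict_eq_zero (by simp)
    simp [this, corr, h0]
  | succ n ih =>
    intro U hU
    obtain ⟨S, hSU, hS⟩ := Finset.exists_subset_card_eq (Nat.min_le_left U.card k)
    have h1 := h S (by omega)
    have h2 := ih (U \ S) (by
      have := Finset.card_sdiff_add_card_eq_card hSU
      have e : (n + 1) * k = n * k + k := by ring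
      rw [e] at hU
      rcases le_total U.card k with h | h
      · rw [min_eq_left h] at hS; omega
      · rw [min_eq_right h] at hS; omega)
    have h3 := l2_restrict_union_le S (U \ S) (Dᵀ *ᵥ e)
    rw [Finset.union_sdiff_of_subset hSU] at h3
    change corr D U e ≤ corr D S e + corr D (U \ S) e at h3
    push_cast
    linarith

lemma IsMaxCorr.corr_le {K : ℕ} (hKN : K ≤ N) {e : Fin m → ℝ} {T : Finset (Fin N)}
    (hT : IsMaxCorr D K e T) {U : Finset (Fin N)} (hU : U.card ≤ K) :
    corr D U e ≤ corr D T e := by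
  obtain ⟨V, hUV, hV⟩ := Finset.exists_superset_card_eq hU (by simpa using hKN)
  exact (corr_mono hUV e).trans (hT.2 V hV)

end RIP

section LeastSquares

variable {m N : ℕ} {D : Matrix (Fin m) (Fin N) ℝ} {k : ℕ} {δ : ℝ}

lemma lsq_apply_of_notMem (T : Finset (Fin N)) (y : Fin m → ℝ) {i : Fin N} (hi : i ∉ T) :
    lsq D T y i = 0 := by simp [lsq, hi]

/-- Extension by zero of a vector indexed by `T`. -/
def extend (T : Finset (Fin N)) (v : T → ℝ) : Fin N → ℝ :=
  fun i => if h : i ∈ T then v ⟨i, h⟩ else 0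

lemma extend_apply_of_notMem (T : Finset (Fin N)) (v : T → ℝ) {i : Fin N} (hi : i ∉ T) :
    extend T v i = 0 := by simp [extend, hi]

lemma mulVec_extend (T : Finset (Fin N)) (v : T → ℝ) :
    D *ᵥ extend T v = subcols D T *ᵥ v := by
  ext i
  simp only [Matrix.mulVec, dotProduct, subcols, Matrix.submatrix_apply, id]
  rw [← Finset.sum_subset (Finset.subset_univ T) (fun j _ hj => by
    rw [extend_apply_of_notMem T v hj, mul_zero]), ← Finset.sum_coe_sort T]
  exact Finset.sum_congr rfl fun j _ => by simp [extend]

lemma HasRIP.isUnit_gram (h : HasRIP D k δ) (hδ : δ < 1) {T : Finset (Fin N)}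
    (hT : T.card ≤ k) : IsUnit ((subcols D T)ᵀ * subcols D T).det := by
  rw [← Matrix.isUnit_iff_isUnit_det, ← Matrix.mulVec_injective_iff_isUnit]
  intro a b hab
  have h0 : ((subcols D T)ᵀ * subcols D T) *ᵥ (a - b) = 0 := by
    rw [Matrix.mulVec_sub]; exact sub_eq_zero.2 hab
  have h1 : l2 (D *ᵥ extend T (a - b)) ^ 2 = 0 := by
    rw [l2_sq_eq_dotProduct, mulVec_extend, Matrix.dotProduct_mulVec, ← Matrix.mulVec_transpose,
      Matrix.mulVec_mulVec, h0, zero_dotProduct]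
  have h2 := (h.2 (extend T (a - b)) ((card_support_le fun i hi =>
    extend_apply_of_notMem T _ hi).trans hT)).1
  have h3 : l2 (extend T (a - b)) = 0 := by
    have := sq_nonneg (l2 (extend T (a - b)))
    have : l2 (extend T (a - b)) ^ 2 = 0 := by nlinarith
    simpa using this
  ext i
  have := congrFun (l2_eq_zero h3) i
  simpa [extend, sub_eq_zero] using this

/-- The normal equations of the least-squares problem on `T`. -/
lemma HasRIP.restrict_residual (h : HasRIP D k δ) (hδ : δ < 1) {T : Finset (Fin N)}
    (hT : T.card ≤ k) (y : Fin m → ℝ) :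
    restrict T (Dᵀ *ᵥ (y - D *ᵥ lsq D T y)) = 0 := by
  refine restrict_eq_zero fun i hi => ?_
  have h1 : D *ᵥ lsq D T y = subcols D T *ᵥ
      ((((subcols D T)ᵀ * subcols D T)⁻¹ * (subcols D T)ᵀ) *ᵥ y) := mulVec_extend T _
  have h2 : (subcols D T)ᵀ *ᵥ (y - D *ᵥ lsq D T y) = 0 := by
    rw [h1, Matrix.mulVec_sub, Matrix.mulVec_mulVec, Matrix.mulVec_mulVec, ← Matrix.mul_assoc,
      Matrix.mul_nonsing_inv _ (h.isUnit_gram hδ hT), Matrix.one_mul, sub_self]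
  exact congrFun h2 ⟨i, hi⟩

lemma HasRIP.l2_restrict_sub_lsq_le (h : HasRIP D k δ) (hδ : δ < 1) {x : Fin N → ℝ}
    {T S : Finset (Fin N)} (hTS : (T ∪ S).card ≤ k) (hx : ∀ i ∉ T, x i = 0) (e : Fin m → ℝ) :
    l2 (restrict S (x - lsq D S (D *ᵥ x + e))) ≤
      δ * l2 (x - lsq D S (D *ᵥ x + e)) + corr D S e := by
  set y := D *ᵥ x + e with hy
  set w := x - lsq D S y with hw
  have h1 := h.restrict_residual hδ
    ((Finset.card_le_card Finset.subset_union_right).trans hTS) y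
  have h2 : y - D *ᵥ lsq D S y = D *ᵥ w + e := by
    rw [hw, Matrix.mulVec_sub, hy]; abel
  rw [h2, Matrix.mulVec_add] at h1
  have h3 : restrict S w = -(restrict S (Dᵀ *ᵥ (D *ᵥ w) - w) + restrict S (Dᵀ *ᵥ e)) := by
    rw [restrict_sub S (Dᵀ *ᵥ (D *ᵥ w)) w]
    rw [restrict_add] at h1
    linear_combination h1
  have h4 := h.l2_restrict_gram_sub_le (w := w) (R := T ∪ S) (U := S)
    (by rwa [Finset.union_assoc, Finset.union_self]) (fun i hi => by
      simp only [Finset.mem_union, not_or] at hi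
      simp [hw, hx i hi.1, lsq_apply_of_notMem S y hi.2])
  rw [h3, l2_neg]
  exact (l2_add_le _ _).trans (add_le_add h4 le_rfl)

lemma HasRIP.l2_sub_lsq_le (h : HasRIP D k δ) (hδ : δ < 1) {x : Fin N → ℝ}
    {T S : Finset (Fin N)} (hTS : (T ∪ S).card ≤ k) (hx : ∀ i ∉ T, x i = 0) (e : Fin m → ℝ) :
    (1 - δ) * l2 (x - lsq D S (D *ᵥ x + e)) ≤ l2 (restrict Sᶜ x) + corr D S e := by
  have h1 := h.l2_restrict_sub_lsq_le hδ hTS hx e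
  have h2 := l2_restrict_union_le Sᶜ S (x - lsq D S (D *ᵥ x + e))
  rw [Finset.union_comm, Finset.union_compl, restrict_eq_self (by simp)] at h2
  rw [restrict_congr (T := Sᶜ) (w := x) fun i hi => by
    simp [lsq_apply_of_notMem S _ (Finset.mem_compl.1 hi)]] at h2
  linarith

end LeastSquares

section Iterations

variable {m N K : ℕ} {D : Matrix (Fin m) (Fin N) ℝ} {δ η : ℝ} {x : Fin N → ℝ}
  {T : Finset (Fin N)} {e : Fin m → ℝ}

/-- A linear recursion with contraction factor at most one half. -/
lemma le_of_recursion {a : ℕ → ℝ} {ρ c : ℝ} (ha : ∀ ℓ, 0 ≤ a ℓ) (hρ : ρ ≤ 1 / 2) (hc : 0 ≤ c)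
    (h : ∀ ℓ, a (ℓ + 1) ≤ ρ * a ℓ + c) (ℓ : ℕ) : a ℓ ≤ a 0 / 2 ^ ℓ + 2 * c := by
  induction ℓ with
  | zero => simpa using hc
  | succ ℓ ih =>
    have h1 := h ℓ
    have h2 := mul_le_mul_of_nonneg_right hρ (ha ℓ)
    have h3 : a 0 / 2 ^ (ℓ + 1) = a 0 / 2 ^ ℓ / 2 := by rw [pow_succ]; field_simp
    rw [h3]
    linarith

/-- Detection of the missing support by correlating with the residual. -/
lemma HasRIP.l2_restrict_sdiff_le {k j : ℕ} (h : HasRIP D k δ) {w : Fin N → ℝ}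
    {R U S : Finset (Fin N)} (hw : ∀ i ∉ R, w i = 0) (hU : U ⊆ R) (hUj : U.card ≤ j)
    (hS : IsTopSupport j (Dᵀ *ᵥ (D *ᵥ w + e)) S) (hRS : (R ∪ S).card ≤ k)
    (hη : ∀ V : Finset (Fin N), V.card ≤ j → corr D V e ≤ η)
    (hR : ∀ i ∈ R \ U, (Dᵀ *ᵥ (D *ᵥ w + e)) i = 0) :
    l2 (restrict (U \ S) w) ≤ 2 * δ * l2 w + 2 * η := by
  set g := Dᵀ *ᵥ (D *ᵥ w + e) with hg
  have hSj : S.card ≤ j := hS.1 ▸ min_le_left _ _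
  have hgw : g = w + (Dᵀ *ᵥ (D *ᵥ w) - w) + Dᵀ *ᵥ e := by
    rw [hg, Matrix.mulVec_add]; abel
  have h1 := hS.l2_sdiff_le hUj
  have h2 : restrict (S \ U) g = restrict (S \ R) g := by
    ext i
    by_cases hiS : i ∈ S <;> by_cases hiU : i ∈ U <;> by_cases hiR : i ∈ R <;>
      simp [restrict, hiS, hiU, hiR]
    · exact absurd (hU hiU) hiR
    · exact hR i (Finset.mem_sdiff.2 ⟨hiR, hiU⟩)
  have h3 : restrict (S \ R) g = restrict (S \ R) (Dᵀ *ᵥ (D *ᵥ w) - w + Dᵀ *ᵥ e) :=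
    restrict_congr fun i hi => by
      rw [hgw]; simp [hw i (Finset.mem_sdiff.1 hi).2]
  have h4 : l2 (restrict (S \ R) (Dᵀ *ᵥ (D *ᵥ w) - w)) ≤ δ * l2 w :=
    h.l2_restrict_gram_sub_le
      ((Finset.card_le_card (Finset.union_subset_union_right Finset.sdiff_subset)).trans hRS) hw
  have h5 : l2 (restrict (U \ S) (Dᵀ *ᵥ (D *ᵥ w) - w)) ≤ δ * l2 w :=
    h.l2_restrict_gram_sub_le
      ((Finset.card_le_card (Finset.union_subset Finset.subset_union_left
        (Finset.sdiff_subset.trans (hU.trans Finset.subset_union_left)))).trans hRS) hw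
  have h6 := hη (S \ R) ((Finset.card_le_card Finset.sdiff_subset).trans hSj)
  have h7 := hη (U \ S) ((Finset.card_le_card Finset.sdiff_subset).trans hUj)
  have h8 := l2_restrict_add_le (S \ R) (Dᵀ *ᵥ (D *ᵥ w) - w) (Dᵀ *ᵥ e)
  have h9 : w = g - (Dᵀ *ᵥ (D *ᵥ w) - w) - Dᵀ *ᵥ e := by rw [hgw]; abel
  have h10 : l2 (restrict (U \ S) w) ≤ l2 (restrict (U \ S) g) +
      l2 (restrict (U \ S) (Dᵀ *ᵥ (D *ᵥ w) - w)) + l2 (restrict (U \ S) (Dᵀ *ᵥ e)) := by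
    conv_lhs => rw [h9]
    exact (l2_restrict_sub_le _ _ _).trans (by gcongr; exact l2_restrict_sub_le _ _ _)
  rw [h2, h3] at h1
  unfold corr at h6 h7
  linarith

lemma restrict_compl_eq (hx : ∀ i ∉ T, x i = 0) (S : Finset (Fin N)) :
    restrict Sᶜ x = restrict (T \ S) x := by
  ext i
  by_cases h1 : i ∈ S <;> by_cases h2 : i ∈ T <;> simp [restrict, h1, h2, hx]

/-- One iteration of Subspace Pursuit reduces the energy outside the support estimate. -/
lemma sp_step (h : HasRIP D (3 * K) δ) (hδ : δ < 1) (hT : T.card ≤ K)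
    (hx : ∀ i ∉ T, x i = 0) (hη : ∀ V : Finset (Fin N), V.card ≤ K → corr D V e ≤ η)
    {T₀ TΔ T₁ : Finset (Fin N)} (hT₀ : T₀.card ≤ K)
    (hΔ : IsTopSupport K (Dᵀ *ᵥ (D *ᵥ x + e - D *ᵥ lsq D T₀ (D *ᵥ x + e))) TΔ)
    (hT₁ : IsTopSupport K (lsq D (T₀ ∪ TΔ) (D *ᵥ x + e)) T₁) :
    l2 (restrict T₁ᶜ x) ≤ 2 * δ * (1 + δ) / (1 - δ) ^ 3 * l2 (restrict T₀ᶜ x) +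
      (6 - 6 * δ + 4 * δ ^ 2) / (1 - δ) ^ 3 * η := by
  have hδ0 := h.1
  have h1δ : 0 < 1 - δ := by linarith
  have hΔK : TΔ.card ≤ K := hΔ.1 ▸ min_le_left _ _
  have hη0 : 0 ≤ η := (corr_nonneg ∅ e).trans (hη ∅ (by simp))
  set y := D *ᵥ x + e with hy
  set w := x - lsq D T₀ y with hw
  set S := T₀ ∪ TΔ with hS
  set p := lsq D S y with hp
  have hres : y - D *ᵥ lsq D T₀ y = D *ᵥ w + e := by
    rw [hw, Matrix.mulVec_sub, hy]; abel
  rw [hres] at hΔ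
  have c1 := Finset.card_union_le T T₀
  have c2 := Finset.card_union_le (T ∪ T₀) TΔ
  have hwR : ∀ i ∉ T ∪ T₀, w i = 0 := fun i hi => by
    simp only [Finset.mem_union, not_or] at hi
    simp [hw, hx i hi.1, lsq_apply_of_notMem T₀ y hi.2]
  -- the previous estimate
  have a1 : (1 - δ) * l2 w ≤ l2 (restrict T₀ᶜ x) + η :=
    (h.l2_sub_lsq_le hδ (by omega) hx e).trans (by gcongr; exact hη _ hT₀)
  -- detection
  have a2 : l2 (restrict ((T \ T₀) \ TΔ) w) ≤ 2 * δ * l2 w + 2 * η := by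
    refine h.l2_restrict_sdiff_le hwR (Finset.sdiff_subset.trans Finset.subset_union_left)
      ((Finset.card_le_card Finset.sdiff_subset).trans hT) hΔ (by omega) hη fun i hi => ?_
    have hi0 : i ∈ T₀ := by simp at hi; tauto
    have := congrFun (h.restrict_residual hδ (by omega : T₀.card ≤ 3 * K) y) i
    rw [hres] at this
    simpa [restrict, hi0] using this
  have a3 : restrict Sᶜ x = restrict ((T \ T₀) \ TΔ) w := by
    have : T \ S = (T \ T₀) \ TΔ := by
      ext i; simp only [hS, Finset.mem_sdiff, Finset.mem_union]; tauto
    rw [restrict_compl_eq hx, this]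
    refine restrict_congr fun i hi => ?_
    have : i ∉ T₀ := by simp only [Finset.mem_sdiff] at hi; exact hi.1.2
    simp [hw, lsq_apply_of_notMem T₀ y this]
  -- the enlarged least-squares problem
  have hTS : (T ∪ S).card ≤ 3 * K := by rw [hS, ← Finset.union_assoc]; omega
  have hSc : S.card ≤ 2 * K := (Finset.card_union_le _ _).trans (by omega)
  have hηS : corr D S e ≤ 2 * η := by exact_mod_cast corr_le_mul hη 2 S hSc
  have b1 := h.l2_sub_lsq_le hδ hTS hx e
  have b2 := h.l2_restrict_sub_lsq_le hδ hTS hx e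
  rw [← hy, ← hp] at b1 b2
  -- pruning
  have c3 := hT₁.l2_sdiff_le hT
  have c4 : l2 (restrict (T₁ \ T) p) ≤ l2 (restrict S (x - p)) := by
    have : restrict (T₁ \ T) p = restrict ((T₁ \ T) ∩ S) (-(x - p)) := by
      ext i
      by_cases h1 : i ∈ T₁ <;> by_cases h2 : i ∈ T <;> by_cases h3 : i ∈ S <;>
        simp [restrict, h1, h2, h3, hx]
      simp [hp, lsq_apply_of_notMem S y h3]
    rw [this]
    refine (l2_restrict_mono Finset.inter_subset_right _).trans (le_of_eq ?_)
    rw [← zero_sub, restrict_sub, restrict_eq_zero (by simp), zero_sub, l2_neg]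
  have c5 : l2 (restrict T₁ᶜ x) ≤ l2 (restrict (T \ T₁) p) + l2 (restrict (T \ T₁) (x - p)) := by
    rw [restrict_compl_eq hx]
    have := l2_restrict_add_le (T \ T₁) p (x - p)
    rwa [add_sub_cancel] at this
  have c6 : l2 (restrict (T \ T₁) (x - p)) ≤ l2 (restrict Sᶜ x) + l2 (restrict S (x - p)) := by
    have h1 := l2_restrict_le (T \ T₁) (x - p)
    have h2 := l2_restrict_union_le Sᶜ S (x - p)
    rw [Finset.union_comm, Finset.union_compl, restrict_eq_self (v := x - p) (by simp),
      restrict_congr (T := Sᶜ) (w := x) fun i hi => by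
        simp [hp, lsq_apply_of_notMem S _ (Finset.mem_compl.1 hi)]] at h2
    exact h1.trans h2
  rw [← a3] at a2
  set A := l2 (restrict T₀ᶜ x)
  set B := l2 (restrict Sᶜ x)
  set C := l2 (restrict T₁ᶜ x)
  set Z := l2 (restrict S (x - p))
  have d1 : C ≤ B + 2 * Z := by linarith
  have d2 : (1 - δ) * Z ≤ δ * B + 2 * η := by
    have := mul_le_mul_of_nonneg_left b1 hδ0
    have := mul_le_mul_of_nonneg_left b2 h1δ.le
    nlinarith
  have d3 : (1 - δ) * B ≤ 2 * δ * A + 2 * η := by nlinarith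
  have d4 : (1 - δ) * C ≤ (1 + δ) * B + 4 * η := by nlinarith
  have d5 : (1 - δ) ^ 2 * C ≤ (1 + δ) * (2 * δ * A + 2 * η) + (1 - δ) * (4 * η) := by
    have := mul_le_mul_of_nonneg_left d4 h1δ.le
    have := mul_le_mul_of_nonneg_left d3 (by linarith : 0 ≤ 1 + δ)
    nlinarith
  have hA : 0 ≤ A := l2_nonneg _
  have d6 : (1 - δ) ^ 3 * C ≤ 2 * δ * (1 + δ) * A + (6 - 6 * δ + 4 * δ ^ 2) * η := by
    have e1 := mul_le_mul_of_nonneg_left d5 h1δ.le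
    have e2 : 0 ≤ δ ^ 2 * (1 + δ) * A := by positivity
    have e3 : 0 ≤ (δ + δ ^ 2) * η := by positivity
    linarith
  rw [div_mul_eq_mul_div, div_mul_eq_mul_div, ← add_div, le_div_iff₀ (by positivity), mul_comm]
  exact d6

/-- One iteration of CoSaMP. -/
lemma cosamp_step (h : HasRIP D (4 * K) δ) (hδ : δ < 1) (hT : T.card ≤ K)
    (hx : ∀ i ∉ T, x i = 0) (hη : ∀ V : Finset (Fin N), V.card ≤ K → corr D V e ≤ η)
    {T₀ TΔ T₁ : Finset (Fin N)} (hT₀ : T₀.card ≤ K) {z : Fin N → ℝ} (hz : ∀ i ∉ T₀, z i = 0)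
    (hΔ : IsTopSupport (2 * K) (Dᵀ *ᵥ (D *ᵥ x + e - D *ᵥ z)) TΔ)
    (hT₁ : IsTopSupport K (lsq D (T₀ ∪ TΔ) (D *ᵥ x + e)) T₁) :
    l2 (x - restrict T₁ (lsq D (T₀ ∪ TΔ) (D *ᵥ x + e))) ≤
      4 * δ / (1 - δ) * l2 (x - z) + 14 / (1 - δ) * η := by
  have hδ0 := h.1
  have h1δ : 0 < 1 - δ := by linarith
  have hΔK : TΔ.card ≤ 2 * K := hΔ.1 ▸ min_le_left _ _
  set y := D *ᵥ x + e with hy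
  set w := x - z with hw
  set S := T₀ ∪ TΔ with hS
  set p := lsq D S y with hp
  have hres : y - D *ᵥ z = D *ᵥ w + e := by
    rw [hw, Matrix.mulVec_sub, hy]; abel
  rw [hres] at hΔ
  have c1 := Finset.card_union_le T T₀
  have c2 := Finset.card_union_le (T ∪ T₀) TΔ
  have hwR : ∀ i ∉ T ∪ T₀, w i = 0 := fun i hi => by
    simp only [Finset.mem_union, not_or] at hi
    simp [hw, hx i hi.1, hz i hi.2]
  have a1 : l2 (restrict ((T ∪ T₀) \ TΔ) w) ≤ 2 * δ * l2 w + 2 * (2 * η) :=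
    h.l2_restrict_sdiff_le hwR subset_rfl (by omega) hΔ (by omega)
      (fun V hV => by exact_mod_cast corr_le_mul hη 2 V hV) (by simp)
  have a2 : l2 (restrict Sᶜ x) ≤ l2 (restrict ((T ∪ T₀) \ TΔ) w) := by
    have : restrict Sᶜ x = restrict (T \ S) w := by
      rw [restrict_compl_eq hx]
      refine restrict_congr fun i hi => ?_
      have : i ∉ T₀ := by simp [hS] at hi; tauto
      simp [hw, hz i this]
    rw [this]
    refine l2_restrict_mono (fun i hi => ?_) w
    simp [hS] at hi ⊢; tauto
  have hTS : (T ∪ S).card ≤ 4 * K := by rw [hS, ← Finset.union_assoc]; omega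
  have hSc : S.card ≤ 3 * K := (Finset.card_union_le _ _).trans (by omega)
  have hηS : corr D S e ≤ 3 * η := by exact_mod_cast corr_le_mul hη 3 S hSc
  have b1 := h.l2_sub_lsq_le hδ hTS hx e
  rw [← hy, ← hp] at b1
  have c3 := hT₁.l2_sub_restrict_le hT hx (Finset.subset_univ _) (Finset.subset_univ _)
  rw [restrict_eq_self (v := p - restrict T₁ p) (by simp),
    restrict_eq_self (v := x - p) (by simp)] at c3
  have c4 := l2_add_le (x - p) (p - restrict T₁ p)
  rw [sub_add_sub_cancel] at c4
  rw [div_mul_eq_mul_div, div_mul_eq_mul_div, ← add_div, le_div_iff₀ h1δ]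
  nlinarith

/-- One iteration of Iterative Hard Thresholding. -/
lemma iht_step (h : HasRIP D (3 * K) δ) (hT : T.card ≤ K)
    (hx : ∀ i ∉ T, x i = 0) (hη : ∀ V : Finset (Fin N), V.card ≤ K → corr D V e ≤ η)
    {T₀ T₁ : Finset (Fin N)} (hT₀ : T₀.card ≤ K) {z : Fin N → ℝ} (hz : ∀ i ∉ T₀, z i = 0)
    (hT₁ : IsTopSupport K (z + Dᵀ *ᵥ (D *ᵥ x + e - D *ᵥ z)) T₁) :
    l2 (x - restrict T₁ (z + Dᵀ *ᵥ (D *ᵥ x + e - D *ᵥ z))) ≤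
      2 * δ * l2 (x - z) + 4 * η := by
  have hT₁K : T₁.card ≤ K := hT₁.1 ▸ min_le_left _ _
  set p := z + Dᵀ *ᵥ (D *ᵥ x + e - D *ᵥ z) with hp
  set w := x - z with hw
  have hpx : p - x = Dᵀ *ᵥ (D *ᵥ w) - w + Dᵀ *ᵥ e := by
    simp only [hp, hw, Matrix.mulVec_sub, Matrix.mulVec_add]; abel
  have c1 := Finset.card_union_le T T₀
  have c2 := Finset.card_union_le (T ∪ T₀) T₁
  have c3 := Finset.card_union_le T T₁
  have hwR : ∀ i ∉ T ∪ T₀, w i = 0 := fun i hi => by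
    simp only [Finset.mem_union, not_or] at hi
    simp [hw, hx i hi.1, hz i hi.2]
  have a1 : l2 (restrict (T ∪ T₁) (Dᵀ *ᵥ (D *ᵥ w) - w)) ≤ δ * l2 w := by
    refine h.l2_restrict_gram_sub_le (le_trans (Finset.card_le_card (t := T ∪ T₀ ∪ T₁) ?_)
      (by omega)) hwR
    intro i hi; simp at hi ⊢; tauto
  have a2 : corr D (T ∪ T₁) e ≤ 2 * η := by
    exact_mod_cast corr_le_mul hη 2 (T ∪ T₁) (by omega)
  have a3 : l2 (restrict (T ∪ T₁) (p - x)) ≤ δ * l2 w + 2 * η := by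
    rw [hpx]; exact (l2_restrict_add_le _ _ _).trans (add_le_add a1 a2)
  have b1 := hT₁.l2_sub_restrict_le hT hx (Finset.subset_union_left (s₂ := T₁))
    Finset.subset_union_right
  have b2 := l2_restrict_add_le (T ∪ T₁) (x - p) (p - restrict T₁ p)
  rw [sub_add_sub_cancel, restrict_eq_self (v := x - restrict T₁ p) fun i hi => by
    simp only [Finset.mem_union, not_or] at hi
    simp [hx i hi.1, restrict, hi.2]] at b2
  have b3 : l2 (restrict (T ∪ T₁) (x - p)) = l2 (restrict (T ∪ T₁) (p - x)) := by
    rw [restrict_sub, restrict_sub, l2_sub_comm]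
  linarith

end Iterations

section Recovery

variable {m N K : ℕ} {D : Matrix (Fin m) (Fin N) ℝ}

lemma ripConst_le_of_ripCondition {alg : Algorithm} (hD : RIPCondition D K alg) :
    ripConst D K ≤ 0.178 := by
  cases alg with
  | SP => exact (ripConst_mono D (by omega)).trans (le_trans hD (by norm_num))
  | CoSaMP => exact (ripConst_mono D (by omega)).trans (le_trans hD (by norm_num))
  | IHT =>
    refine (ripConst_mono D (by omega)).trans (le_trans hD ?_)
    rw [div_le_iff₀ (by positivity)]
    have : (5.62 : ℝ) ≤ √32 := Real.le_sqrt_of_sq_le (by norm_num)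
    linarith

lemma errConst_le_absConst {alg : Algorithm} (hD : RIPCondition D K alg) :
    errConst D K alg ≤ absConst alg := by
  cases alg with
  | SP =>
    have h0 := ripConst_nonneg D (3 * K)
    have h1 : ripConst D (3 * K) ≤ 0.139 := hD
    simp only [errConst, absConst]
    set δ := ripConst D (3 * K)
    have e1 : 7 - 9 * δ + 7 * δ ^ 2 - δ ^ 3 ≤ 21.41 / 2 * (1 - δ) ^ 4 := by
      have hs : 0 ≤ 0.139 - δ := by linarith
      have hs0 : 0 ≤ 1 - δ := by linarith
      nlinarith [mul_nonneg hs hs0, mul_nonneg hs (pow_nonneg hs0 2),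
        mul_nonneg hs (pow_nonneg hs0 3)]
    have : (7 - 9 * δ + 7 * δ ^ 2 - δ ^ 3) / (1 - δ) ^ 4 ≤ 21.41 / 2 := by
      rwa [div_le_iff₀ (pow_pos (by linarith) 4)]
    linarith
  | CoSaMP =>
    have h0 := ripConst_nonneg D (4 * K)
    have h1 : ripConst D (4 * K) ≤ 0.1 := hD
    simp only [errConst, absConst]
    set δ := ripConst D (4 * K)
    rw [div_le_iff₀ (pow_pos (by linarith) 2)]
    nlinarith
  | IHT => exact le_rfl

/-- Recovery of a `K`-sparse vector: the error after `ℓ` iterations is controlled by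
a geometrically decreasing term and the noise correlation. -/
lemma exists_sparse_bound {alg : Algorithm} (hD : RIPCondition D K alg) :
    ∃ α β : ℝ, 1 ≤ α ∧ 0 ≤ β ∧ α + β = errConst D K alg ∧
      ∀ (x : Fin N → ℝ) (T : Finset (Fin N)) (e : Fin m → ℝ) (η : ℝ) (xhat : ℕ → Fin N → ℝ),
        T.card ≤ K → (∀ i ∉ T, x i = 0) →
        (∀ V : Finset (Fin N), V.card ≤ K → corr D V e ≤ η) →
        IsRun alg D (D *ᵥ x + e) K xhat →
        ∀ ℓ, l2 (x - xhat ℓ) ≤ α * (l2 x / 2 ^ ℓ) + β * η := by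
  cases alg with
  | SP =>
    have h0 := ripConst_nonneg D (3 * K)
    have h1 : ripConst D (3 * K) ≤ 0.139 := hD
    have hrip := hasRIP_ripConst D (3 * K)
    simp only [errConst]
    set δ := ripConst D (3 * K)
    have hδ : δ < 1 := by linarith
    have h1δ : 0 < 1 - δ := by linarith
    have hq : 0 ≤ 6 - 6 * δ + 4 * δ ^ 2 := by nlinarith
    refine ⟨1 / (1 - δ), 2 * (6 - 6 * δ + 4 * δ ^ 2) / (1 - δ) ^ 4 + 1 / (1 - δ), ?_, ?_, ?_, ?_⟩
    · rw [le_div_iff₀ h1δ]; linarith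
    · positivity
    · field_simp; ring
    intro x T e η xhat hT hx hη ⟨S, hS0, hS, hxhat⟩ ℓ
    have hη0 : 0 ≤ η := (corr_nonneg ∅ e).trans (hη ∅ (by simp))
    have hSK : ∀ ℓ, (S ℓ).card ≤ K := by
      intro ℓ
      cases ℓ with
      | zero => simp [hS0]
      | succ ℓ =>
        obtain ⟨_, _, h⟩ := hS ℓ
        exact h.1 ▸ min_le_left _ _
    have hρ : 2 * δ * (1 + δ) / (1 - δ) ^ 3 ≤ 1 / 2 := by
      rw [div_le_iff₀ (by positivity)]
      have hs : 0 ≤ 0.139 - δ := by linarith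
      nlinarith [mul_nonneg h0 hs, mul_nonneg (pow_nonneg h0 2) hs]
    have hrec := le_of_recursion (a := fun ℓ => l2 (restrict (S ℓ)ᶜ x))
      (fun _ => l2_nonneg _) hρ
      (c := (6 - 6 * δ + 4 * δ ^ 2) / (1 - δ) ^ 3 * η) (by positivity)
      (fun ℓ => by
        obtain ⟨TΔ, h2, h3⟩ := hS ℓ
        exact sp_step hrip hδ hT hx hη (hSK ℓ) h2 h3) ℓ
    simp only [hS0, Finset.compl_empty, restrict_eq_self (T := Finset.univ) (v := x) (by simp)]
      at hrec
    have hfin := hrip.l2_sub_lsq_le hδ (T := T) (S := S ℓ) (x := x)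
      ((Finset.card_union_le _ _).trans (by have := hSK ℓ; omega)) hx e
    have := hη _ (hSK ℓ)
    rw [hxhat]
    rw [← le_div_iff₀' h1δ] at hfin
    refine hfin.trans ?_
    calc _ ≤ (l2 x / 2 ^ ℓ + 2 * ((6 - 6 * δ + 4 * δ ^ 2) / (1 - δ) ^ 3 * η) + η) / (1 - δ) := by
          gcongr
      _ = _ := by field_simp; ring
  | CoSaMP =>
    have h0 := ripConst_nonneg D (4 * K)
    have h1 : ripConst D (4 * K) ≤ 0.1 := hD
    have hrip := hasRIP_ripConst D (4 * K)
    simp only [errConst]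
    set δ := ripConst D (4 * K)
    have hδ : δ < 1 := by linarith
    have h1δ : 0 < 1 - δ := by linarith
    have hq : 0 ≤ 14 - 6 * δ := by linarith
    refine ⟨1, 2 * (14 - 6 * δ) / (1 - δ) ^ 2, le_rfl, by positivity, ?_, ?_⟩
    · field_simp; ring
    intro x T e η xhat hT hx hη ⟨S, hS0, hx0, hS⟩ ℓ
    have hη0 : 0 ≤ η := (corr_nonneg ∅ e).trans (hη ∅ (by simp))
    have hSK : ∀ ℓ, (S ℓ).card ≤ K ∧ ∀ i ∉ S ℓ, xhat ℓ i = 0 := by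
      intro ℓ
      cases ℓ with
      | zero => simp [hS0, hx0]
      | succ ℓ =>
        obtain ⟨_, _, h, h'⟩ := hS ℓ
        exact ⟨h.1 ▸ min_le_left _ _, fun i hi => by rw [h']; exact restrict_apply_of_notMem _ hi⟩
    have hρ : 4 * δ / (1 - δ) ≤ 1 / 2 := by
      rw [div_le_iff₀ (by positivity)]; linarith
    have hc : 14 / (1 - δ) ≤ (14 - 6 * δ) / (1 - δ) ^ 2 := by
      rw [div_le_div_iff₀ h1δ (by positivity)]; nlinarith
    have hrec := le_of_recursion (a := fun ℓ => l2 (x - xhat ℓ))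
      (fun _ => l2_nonneg _) hρ
      (c := (14 - 6 * δ) / (1 - δ) ^ 2 * η) (by positivity)
      (fun ℓ => by
        obtain ⟨TΔ, h2, h3, h4⟩ := hS ℓ
        simp only [h4]
        refine (cosamp_step hrip hδ hT hx hη (hSK ℓ).1 (hSK ℓ).2 h2 h3).trans ?_
        gcongr) ℓ
    simp only [hx0, sub_zero] at hrec
    refine hrec.trans (le_of_eq (by ring))
  | IHT =>
    have h1 : ripConst D (3 * K) ≤ 1 / √32 := hD
    have hrip := hasRIP_ripConst D (3 * K)
    have h32 : 1 / √32 ≤ (0.25 : ℝ) := by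
      rw [div_le_iff₀ (by positivity)]
      have : (4 : ℝ) ≤ √32 := Real.le_sqrt_of_sq_le (by norm_num)
      linarith
    refine ⟨1, 8, le_rfl, by norm_num, by norm_num [errConst], ?_⟩
    intro x T e η xhat hT hx hη ⟨hx0, hS⟩ ℓ
    have hη0 : 0 ≤ η := (corr_nonneg ∅ e).trans (hη ∅ (by simp))
    have hSK : ∀ ℓ, ∃ S : Finset (Fin N), S.card ≤ K ∧ ∀ i ∉ S, xhat ℓ i = 0 := by
      intro ℓ
      cases ℓ with
      | zero => exact ⟨∅, by simp [hx0]⟩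
      | succ ℓ =>
        obtain ⟨S, h, h'⟩ := hS ℓ
        exact ⟨S, h.1 ▸ min_le_left _ _, fun i hi => by
          rw [h']; exact restrict_apply_of_notMem _ hi⟩
    have hrec := le_of_recursion (a := fun ℓ => l2 (x - xhat ℓ))
      (ρ := 2 * ripConst D (3 * K)) (fun _ => l2_nonneg _) (by linarith)
      (c := 4 * η) (by positivity)
      (fun ℓ => by
        obtain ⟨S, h3, h4⟩ := hS ℓ
        obtain ⟨S₀, h5, h6⟩ := hSK ℓ
        simp only [h4]
        exact iht_step hrip hT hx hη h5 h6 h3) ℓ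
    simp only [hx0, sub_zero] at hrec
    refine hrec.trans (le_of_eq (by ring))

lemma errConst_nonneg {alg : Algorithm} (hD : RIPCondition D K alg) : 0 ≤ errConst D K alg := by
  obtain ⟨α, β, hα, hβ, h, _⟩ := exists_sparse_bound hD
  linarith

lemma l2_div_two_pow_le {x : Fin N → ℝ} {T : Finset (Fin N)} {e : Fin m → ℝ}
    (h0 : corr D T e ≠ 0) {ℓ : ℕ} (hℓ : numIter D x T e ≤ ℓ) :
    l2 x / 2 ^ ℓ ≤ corr D T e := by
  have hc : 0 < corr D T e := lt_of_le_of_ne (corr_nonneg T e) h0.symm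
  rcases (l2_nonneg x).eq_or_lt with hx | hx
  · rw [← hx, zero_div]; exact hc.le
  rw [numIter, Int.ceil_le, Int.cast_natCast, Real.logb_le_iff_le_rpow one_lt_two
    (div_pos hx hc), Real.rpow_natCast, div_le_iff₀ hc] at hℓ
  rw [div_le_iff₀ (by positivity)]
  linarith

/-- Recovery of a general vector. -/
lemma l2_sub_le_errConst_mul {alg : Algorithm} (hK : 1 ≤ K) (hKN : K ≤ N)
    (hD : RIPCondition D K alg) {x xK : Fin N → ℝ}
    (hxK : ∃ S, IsTopSupport K x S ∧ xK = restrict S x) {e : Fin m → ℝ}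
    {xhat : ℕ → Fin N → ℝ} {Te : Finset (Fin N)}
    (hrun : IsRun alg D (D *ᵥ x + e) K xhat) (hTe : IsMaxCorr D K e Te)
    (h0 : corr D Te e ≠ 0) {ℓ : ℕ} (hℓ : numIter D x Te e ≤ ℓ) :
    l2 (x - xhat ℓ) ≤ errConst D K alg * (corr D Te e + (1 + ripConst D K) * l2 (x - xK) +
      (1 + ripConst D K) / √(K : ℝ) * l1 (x - xK)) := by
  obtain ⟨S, hS, rfl⟩ := hxK
  obtain ⟨α, β, hα, hβ, hC, hbound⟩ := exists_sparse_bound hD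
  set xK := restrict S x
  have hrip := hasRIP_ripConst D K
  have hδ0 := hrip.1
  set δ := ripConst D K
  set t := l2 (x - xK) + l1 (x - xK) / √K with ht
  have hy : D *ᵥ x + e = D *ᵥ xK + (e + D *ᵥ (x - xK)) := by
    rw [Matrix.mulVec_sub]; abel
  rw [hy] at hrun
  have hη : ∀ V : Finset (Fin N), V.card ≤ K →
      corr D V (e + D *ᵥ (x - xK)) ≤ corr D Te e + (1 + δ) * t := fun V hV =>
    (corr_add_le V _ _).trans
      (add_le_add (hTe.corr_le hKN hV) (hrip.corr_mulVec_le hK hKN hV _))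
  have h1 := hbound xK S _ _ xhat (hS.1 ▸ min_le_left _ _)
    (fun i hi => restrict_apply_of_notMem x hi) hη hrun ℓ
  have h2 : l2 xK / 2 ^ ℓ ≤ corr D Te e := by
    refine le_trans ?_ (l2_div_two_pow_le h0 hℓ)
    gcongr
    exact l2_restrict_le S x
  have h3 := l2_add_le (x - xK) (xK - xhat ℓ)
  rw [sub_add_sub_cancel] at h3
  have h4 : 0 ≤ l1 (x - xK) / √K := div_nonneg (l1_nonneg _) (Real.sqrt_nonneg _)
  have h5 : 0 ≤ l2 (x - xK) := l2_nonneg _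
  have h6 : l2 (x - xK) ≤ α * ((1 + δ) * t) := by
    have : t ≤ (1 + δ) * t := by nlinarith
    nlinarith
  have h7 := mul_le_mul_of_nonneg_left h2 (zero_le_one.trans hα)
  rw [← hC]
  have e1 : (1 + δ) / √K * l1 (x - xK) = (1 + δ) * (l1 (x - xK) / √K) := by ring
  have e2 : corr D Te e + (1 + δ) * l2 (x - xK) + (1 + δ) / √K * l1 (x - xK) =
      corr D Te e + (1 + δ) * t := by rw [e1, ht]; ring
  rw [e2]
  linarith

end Recovery

section Gaussian

/-- The strict Mills bound for the upper tail of a centred Gaussian. -/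
lemma integral_gaussianPDFReal_Ioi_lt {v : ℝ≥0} (hv : v ≠ 0) {t : ℝ} (ht : 0 < t) :
    ∫ x in Set.Ioi t, gaussianPDFReal 0 v x < v * gaussianPDFReal 0 v t / t := by
  have hv0 : (v : ℝ) ≠ 0 := by exact_mod_cast hv
  have hderiv : ∀ x ∈ Set.Ici t, HasDerivAt (fun x => -(v * gaussianPDFReal 0 v x))
      (x * gaussianPDFReal 0 v x) x := fun x _ => by
    simp only [gaussianPDFReal]
    have h1 : HasDerivAt (fun x : ℝ => -(x - 0) ^ 2 / (2 * v)) (-(x / v)) x := by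
      have := ((((hasDerivAt_id x).sub_const 0).pow 2).neg).div_const (2 * (v : ℝ))
      convert! this using 1
      simp; field_simp
    convert! ((h1.exp.const_mul ((√(2 * Real.pi * v))⁻¹)).const_mul (v : ℝ)).neg using 1
    field_simp
  have hlim : Filter.Tendsto (fun x => -(v * gaussianPDFReal 0 v x)) Filter.atTop
      (nhds 0) := by
    have h1 : Filter.Tendsto (fun x : ℝ => -(x - 0) ^ 2 / (2 * v)) Filter.atTop
        Filter.atBot := by
      simp only [neg_div, sub_zero]
      exact Filter.tendsto_neg_atTop_atBot.comp
        ((Filter.tendsto_pow_atTop two_ne_zero).atTop_div_const (by positivity))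
    have h2 := ((Real.tendsto_exp_atBot.comp h1).const_mul ((√(2 * Real.pi * v))⁻¹)).const_mul
      (v : ℝ)
    simpa [gaussianPDFReal] using h2.neg
  have hpos : ∀ x ∈ Set.Ioi t, 0 ≤ x * gaussianPDFReal 0 v x := fun x hx =>
    mul_nonneg (ht.trans hx).le (gaussianPDFReal_nonneg _ _ _)
  have hint := integrableOn_Ioi_deriv_of_nonneg' hderiv hpos hlim
  have hval := integral_Ioi_of_hasDerivAt_of_nonneg' hderiv hpos hlim
  have hφ : IntegrableOn (gaussianPDFReal 0 v) (Set.Ioi t) :=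
    (integrable_gaussianPDFReal 0 v).integrableOn
  have hlt : 0 < ∫ x in Set.Ioi t, (x * gaussianPDFReal 0 v x - t * gaussianPDFReal 0 v x) := by
    have hp : ∀ x ∈ Set.Ioi t, 0 < x * gaussianPDFReal 0 v x - t * gaussianPDFReal 0 v x :=
      fun x hx => by
        rw [← sub_mul]
        exact mul_pos (sub_pos.2 hx) (gaussianPDFReal_pos 0 v x hv)
    rw [setIntegral_pos_iff_support_of_nonneg_ae
      (ae_restrict_of_forall_mem measurableSet_Ioi fun x hx => (hp x hx).le)
      (hint.sub (hφ.const_mul t)), Set.inter_eq_right.2 fun x hx => Function.mem_support.2 (hp x hx).ne']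
    simp
  rw [integral_sub hint (hφ.const_mul t), hval, integral_const_mul] at hlt
  rw [lt_div_iff₀ ht]
  linarith

/-- Two-sided Gaussian tail bound. -/
lemma gaussianReal_abs_gt_lt {σ s : ℝ} (hσ : 0 < σ) (hs : 0 < s) :
    (gaussianReal 0 ⟨σ ^ 2, sq_nonneg σ⟩).real {x | σ * √(2 * s) < |x|} <
      Real.exp (-s) / √(Real.pi * s) := by
  set v : ℝ≥0 := ⟨σ ^ 2, sq_nonneg σ⟩
  have hv : v ≠ 0 := by
    intro h
    have : (v : ℝ) = 0 := by rw [h]; rfl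
    exact (pow_pos hσ 2).ne' this
  set t := σ * √(2 * s) with ht
  have ht0 : 0 < t := by positivity
  have h1 : {x : ℝ | t < |x|} = Set.Ioi t ∪ (fun x => -x) ⁻¹' Set.Ioi t := by
    ext x; simp [lt_abs, lt_neg]
  have h2 : (gaussianReal 0 v).real ((fun x => -x) ⁻¹' Set.Ioi t) =
      (gaussianReal 0 v).real (Set.Ioi t) := by
    rw [← map_measureReal_apply measurable_neg measurableSet_Ioi, gaussianReal_map_neg, neg_zero]
  have h3 : (gaussianReal 0 v).real (Set.Ioi t) = ∫ x in Set.Ioi t, gaussianPDFReal 0 v x := by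
    rw [measureReal_def, gaussianReal_apply_eq_integral 0 hv, ENNReal.toReal_ofReal]
    exact setIntegral_nonneg measurableSet_Ioi fun x _ => gaussianPDFReal_nonneg _ _ _
  have h4 := integral_gaussianPDFReal_Ioi_lt hv ht0
  have h5 : v * gaussianPDFReal 0 v t / t = Real.exp (-s) / √(Real.pi * s) / 2 := by
    have hvv : (v : ℝ) = σ ^ 2 := rfl
    have e1 : -(t - 0) ^ 2 / (2 * (v : ℝ)) = -s := by
      rw [hvv, ht, sub_zero, mul_pow, Real.sq_sqrt (by positivity)]; field_simp
    have e2 : √(2 * Real.pi * (v : ℝ)) * t = 2 * σ ^ 2 * √(Real.pi * s) := by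
      rw [hvv, ht, Real.sqrt_mul (by positivity), Real.sqrt_sq hσ.le]
      have : √(2 * Real.pi) * √(2 * s) = 2 * √(Real.pi * s) := by
        rw [← Real.sqrt_mul (by positivity), show 2 * Real.pi * (2 * s) = 2 ^ 2 * (Real.pi * s)
          by ring, Real.sqrt_mul (by positivity), Real.sqrt_sq (by norm_num)]
      linear_combination σ ^ 2 * this
    rw [gaussianPDFReal, e1, hvv] at *
    rw [show σ ^ 2 * ((√(2 * Real.pi * σ ^ 2))⁻¹ * Real.exp (-s)) / t =
      σ ^ 2 * Real.exp (-s) / (√(2 * Real.pi * σ ^ 2) * t) by field_simp, e2]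
    field_simp
  have h6 := measureReal_union_le (μ := gaussianReal 0 v) (Set.Ioi t)
    ((fun x => -x) ⁻¹' Set.Ioi t)
  rw [h1]
  rw [h2] at h6
  linarith

variable {Ω : Type*} [MeasurableSpace Ω] {P : Measure Ω}
  {m : ℕ} {σ : ℝ} {e : Ω → Fin m → ℝ}

/-- A unit-norm linear combination of white noise has the law of one of its entries. -/
lemma IsWhiteGaussian.hasLaw_dotProduct (he : IsWhiteGaussian P σ e) {c : Fin m → ℝ}
    (hc : l2 c = 1) :
    HasLaw (fun ω => c ⬝ᵥ e ω) (gaussianReal 0 ⟨σ ^ 2, sq_nonneg σ⟩) P := by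
  obtain ⟨hlaw, hind⟩ := he
  have hX : ∀ i, HasLaw (fun ω => c i * e ω i)
      (gaussianReal (c i * 0) (.mk (c i ^ 2) (sq_nonneg _) * ⟨σ ^ 2, sq_nonneg σ⟩)) P := fun i =>
    gaussianReal_const_mul (hlaw i) (c i)
  have hXg : ∀ i, HasGaussianLaw (fun ω => c i * e ω i) P := fun i => (hX i).hasGaussianLaw
  have hXind : iIndepFun (fun i ω => c i * e ω i) P :=
    hind.comp (fun i x => c i * x) fun i => by fun_prop
  have hsum := hXind.hasGaussianLaw_fun_sum hXg
  have hmean : ∀ i, ∫ ω, c i * e ω i ∂P = 0 := fun i => by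
    rw [(hX i).integral_eq]; simp [integral_id_gaussianReal]
  have hvar : ∀ i, Var[fun ω => c i * e ω i; P] = c i ^ 2 * σ ^ 2 := fun i => by
    rw [(hX i).variance_eq, variance_id_gaussianReal]; rfl
  have hm : ∫ ω, ∑ i, c i * e ω i ∂P = 0 := by
    rw [integral_finsetSum _ fun i _ => (hXg i).integrable]
    simp [hmean]
  have hV : Var[fun ω => ∑ i, c i * e ω i; P] = σ ^ 2 := by
    have := IndepFun.variance_sum (μ := P) (X := fun i ω => c i * e ω i) (s := Finset.univ)
      (fun i _ => (hXg i).memLp_two) fun i _ j _ hij => hXind.indepFun hij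
    rw [← Finset.sum_fn] at *
    rw [this]
    simp only [hvar]
    rw [← Finset.sum_mul, ← l2_sq, hc]; ring
  refine ⟨hsum.aemeasurable, ?_⟩
  have := hsum.map_eq_gaussianReal
  rw [hm, hV] at this
  simp only [dotProduct]
  rw [this]
  congr 1
  exact Real.toNNReal_of_nonneg (sq_nonneg σ)

end Gaussian

section Noise

variable {m N K : ℕ} {D : Matrix (Fin m) (Fin N) ℝ}

/-- With high probability, all correlations of the noise with the columns are small and nonzero. -/
lemma exists_noise_event (hcol : ∀ j, l2 (fun i => D i j) = 1) (hN : 2 ≤ N) {σ a : ℝ}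
    (hσ : 0 < σ) (ha : -1 < a) {Ω : Type*} [MeasurableSpace Ω] (P : Measure Ω)
    [IsProbabilityMeasure P] {e : Ω → Fin m → ℝ} (he : IsWhiteGaussian P σ e) :
    ∃ A : Set Ω, MeasurableSet A ∧
      1 - (√(Real.pi * (1 + a) * Real.log N) * (N : ℝ) ^ a)⁻¹ < P.real A ∧
      ∀ ω ∈ A, ∀ j, (Dᵀ *ᵥ e ω) j ≠ 0 ∧
        |(Dᵀ *ᵥ e ω) j| ≤ σ * √(2 * ((1 + a) * Real.log N)) := by
  have hN0 : (0 : ℝ) < N := by positivity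
  have hlog : 0 < Real.log N := Real.log_pos (by exact_mod_cast hN)
  set s := (1 + a) * Real.log N with hs
  have hs0 : 0 < s := mul_pos (by linarith) hlog
  set μ := gaussianReal 0 ⟨σ ^ 2, sq_nonneg σ⟩ with hμ
  have hlaw : ∀ j, HasLaw (fun ω => (Dᵀ *ᵥ e ω) j) μ P := fun j =>
    he.hasLaw_dotProduct (hcol j)
  set B : Fin N → Set Ω := fun j =>
    (fun ω => (Dᵀ *ᵥ e ω) j) ⁻¹' ({x | σ * √(2 * s) < |x|} ∪ {0}) with hB
  have hms : MeasurableSet ({x : ℝ | σ * √(2 * s) < |x|} ∪ {0}) :=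
    (measurableSet_lt measurable_const measurable_abs).union (measurableSet_singleton 0)
  have hBnull : ∀ j, NullMeasurableSet (B j) P := fun j =>
    (hlaw j).aemeasurable.nullMeasurable hms
  have hv : (⟨σ ^ 2, sq_nonneg σ⟩ : ℝ≥0) ≠ 0 := fun h => (pow_pos hσ 2).ne' (congrArg NNReal.toReal h)
  have hμ0 : μ.real {0} = 0 := by
    have := nullSingletonClass_gaussianReal (μ := 0) hv
    simp [measureReal_def, hμ]
  have hBlt : ∀ j, P.real (B j) < Real.exp (-s) / √(Real.pi * s) := fun j => by
    have h1 : P.real (B j) = μ.real ({x : ℝ | σ * √(2 * s) < |x|} ∪ {0}) :=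
      (hlaw j).measureReal_eq hms
    rw [h1]
    refine (measureReal_union_le _ _).trans_lt ?_
    rw [hμ0, add_zero]
    exact gaussianReal_abs_gt_lt hσ hs0
  have hunion : P.real (⋃ j, B j) < N * (Real.exp (-s) / √(Real.pi * s)) := by
    refine (measureReal_iUnion_fintype_le B).trans_lt ?_
    have : Nonempty (Fin N) := ⟨⟨0, by omega⟩⟩
    refine (Finset.sum_lt_sum_of_nonempty Finset.univ_nonempty fun j _ => hBlt j).trans_eq ?_
    simp
  have hconst : N * (Real.exp (-s) / √(Real.pi * s)) =
      (√(Real.pi * (1 + a) * Real.log N) * (N : ℝ) ^ a)⁻¹ := by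
    have e1 : (N : ℝ) * Real.exp (-s) = ((N : ℝ) ^ a)⁻¹ := by
      rw [← Real.rpow_neg hN0.le, Real.rpow_def_of_pos hN0]
      nth_rewrite 1 [← Real.exp_log hN0]
      rw [← Real.exp_add, hs]
      congr 1; ring
    rw [mul_div_assoc', e1, mul_inv, mul_assoc Real.pi, ← hs, div_eq_mul_inv, mul_comm]
  have hnull : NullMeasurableSet (⋃ j, B j)ᶜ P := (NullMeasurableSet.iUnion hBnull).compl
  obtain ⟨A, hAsub, hA, hAeq⟩ := hnull.exists_measurable_subset_ae_eq
  refine ⟨A, hA, ?_, fun ω hω j => ?_⟩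
  · rw [measureReal_congr hAeq, measureReal_compl₀ (NullMeasurableSet.iUnion hBnull),
      probReal_univ, ← hconst]
    linarith
  · have h := hAsub hω
    simp only [Set.mem_compl_iff, Set.mem_iUnion, not_exists] at h
    have h := h j
    simp only [hB, Set.mem_preimage, Set.mem_union, Set.mem_ofPred_eq, Set.mem_singleton_iff,
      not_or, not_lt] at h
    exact ⟨h.2, h.1⟩

lemma corr_le_of_abs_le {T : Finset (Fin N)} (hT : T.card ≤ K) {e : Fin m → ℝ} {M : ℝ}
    (hM0 : 0 ≤ M) (hM : ∀ j, |(Dᵀ *ᵥ e) j| ≤ M) : corr D T e ≤ √K * M := by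
  refine l2_le_of_forall_abs_le hT (fun i hi => restrict_apply_of_notMem _ hi) (fun i => ?_) hM0
  by_cases hi : i ∈ T
  · simpa [restrict, hi] using hM i
  · simpa [restrict, hi] using hM0

lemma corr_ne_zero {T : Finset (Fin N)} (hT : T.Nonempty) {e : Fin m → ℝ}
    (he : ∀ j, (Dᵀ *ᵥ e) j ≠ 0) : corr D T e ≠ 0 := by
  obtain ⟨j, hj⟩ := hT
  intro h
  have := congrFun (l2_eq_zero h) j
  simp only [restrict, hj, if_true, Pi.zero_apply] at this
  exact he j this

end Noise

end SparseRecovery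

theorem mainTheorem10 {m N : ℕ} (K : ℕ) (hK : 1 ≤ K) (hKN : K ≤ N)
    (D : Matrix (Fin m) (Fin N) ℝ) (alg : SparseRecovery.Algorithm)
    (hD : SparseRecovery.RIPCondition D K alg)
    (x xK : Fin N → ℝ)
    (hxK : ∃ S, SparseRecovery.IsTopSupport K x S ∧ xK = SparseRecovery.restrict S x) :
    SparseRecovery.errConst D K alg ≤ SparseRecovery.absConst alg ∧
    (∀ (e : Fin m → ℝ) (xhat : ℕ → Fin N → ℝ) (Te : Finset (Fin N)),
      SparseRecovery.IsRun alg D (D.mulVec x + e) K xhat →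
      SparseRecovery.IsMaxCorr D K e Te →
      SparseRecovery.corr D Te e ≠ 0 →
      ∀ ℓ : ℕ, SparseRecovery.numIter D x Te e ≤ ℓ →
        SparseRecovery.l2 (x - xhat ℓ) ≤ SparseRecovery.errConst D K alg *
          (SparseRecovery.corr D Te e
            + (1 + SparseRecovery.ripConst D K) * SparseRecovery.l2 (x - xK)
            + (1 + SparseRecovery.ripConst D K) / √(K : ℝ) * SparseRecovery.l1 (x - xK))) ∧
    ((∀ j, SparseRecovery.l2 (fun i => D i j) = 1) → 2 ≤ N →
      ∀ (σ a : ℝ), 0 < σ → -1 < a →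
      ∀ {Ω : Type*} [MeasurableSpace Ω] (P : MeasureTheory.Measure Ω)
        [MeasureTheory.IsProbabilityMeasure P] (e : Ω → Fin m → ℝ),
      SparseRecovery.IsWhiteGaussian P σ e →
      ∃ A : Set Ω, MeasurableSet A ∧
        1 - (√(Real.pi * (1 + a) * Real.log N) * (N : ℝ) ^ a)⁻¹ < P.real A ∧
        ∀ ω ∈ A, ∀ (xhat : ℕ → Fin N → ℝ) (Te : Finset (Fin N)),
          SparseRecovery.IsRun alg D (D.mulVec x + e ω) K xhat →
          SparseRecovery.IsMaxCorr D K (e ω) Te →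
          SparseRecovery.corr D Te (e ω) ≠ 0 ∧
          ∀ ℓ : ℕ, SparseRecovery.numIter D x Te (e ω) ≤ ℓ →
            SparseRecovery.l2 (x - xhat ℓ) ^ 2 ≤ 2 * SparseRecovery.errConst D K alg ^ 2 *
              (√((1 + a) * Real.log N * K) * σ
                + SparseRecovery.l2 (x - xK)
                + 1 / √(K : ℝ) * SparseRecovery.l1 (x - xK)) ^ 2) := by
  open SparseRecovery in
  refine ⟨errConst_le_absConst hD, ?_, ?_⟩
  · intro e xhat Te hrun hTe h0 ℓ hℓ
    exact l2_sub_le_errConst_mul hK hKN hD hxK hrun hTe h0 hℓ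
  · intro hcol hN σ a hσ ha Ω _ P _ e he
    obtain ⟨A, hA, hPA, hprop⟩ := exists_noise_event hcol hN hσ ha P he
    refine ⟨A, hA, hPA, fun ω hω xhat Te hrun hTe => ?_⟩
    have h0 : corr D Te (e ω) ≠ 0 :=
      corr_ne_zero (Finset.card_pos.1 (by rw [hTe.1]; omega)) fun j => (hprop ω hω j).1
    refine ⟨h0, fun ℓ hℓ => ?_⟩
    have h1 := l2_sub_le_errConst_mul hK hKN hD hxK hrun hTe h0 hℓ
    have hlog : 0 ≤ Real.log N := Real.log_natCast_nonneg N
    have h2 := corr_le_of_abs_le hTe.1.le (by positivity) fun j => (hprop ω hω j).2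
    have hC := errConst_nonneg hD
    have hδ : 1 + ripConst D K ≤ √2 :=
      Real.le_sqrt_of_sq_le (by
        have := ripConst_le_of_ripCondition hD
        have := ripConst_nonneg D K
        nlinarith)
    have e1 : √(K : ℝ) * (σ * √(2 * ((1 + a) * Real.log N))) =
        √2 * (√((1 + a) * Real.log N * K) * σ) := by
      rw [Real.sqrt_mul (by norm_num), Real.sqrt_mul (mul_nonneg (by linarith) hlog)]
      ring
    rw [e1] at h2
    have h3 : 0 ≤ l2 (x - xK) := l2_nonneg _
    have h4 : 0 ≤ 1 / √(K : ℝ) * l1 (x - xK) := mul_nonneg (by positivity) (l1_nonneg _)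
    have h5 : l2 (x - xhat ℓ) ≤ errConst D K alg * (√2 * (√((1 + a) * Real.log N * K) * σ
        + l2 (x - xK) + 1 / √(K : ℝ) * l1 (x - xK))) := by
      refine h1.trans (mul_le_mul_of_nonneg_left ?_ hC)
      have h6 := mul_le_mul_of_nonneg_right hδ h3
      have h7 := mul_le_mul_of_nonneg_right hδ h4
      have h8 : (1 + ripConst D K) / √(K : ℝ) * l1 (x - xK) =
        (1 + ripConst D K) * (1 / √(K : ℝ) * l1 (x - xK)) := by ring
      rw [h8]
      linarith
    refine (pow_le_pow_left₀ (l2_nonneg _) h5 2).trans (le_of_eq ?_)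
    rw [mul_pow, mul_pow, Real.sq_sqrt (by norm_num)]
    ring
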